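/- Let $\alpha\in(0,1)$. For $M\in\mathbb R^{n\times p}$ and positive definite $\Sigma\in\mathbb R^{p\times p}$, $\Psi\in\mathbb R^{n\times n}$, write $Y\sim N_{n\times p}(M,\Sigma\otimes\Psi)$ if the entries of $Y$ are jointly Gaussian with $E\,Y_{ij}=M_{ij}$ and $\mathrm{Cov}(Y_{ij},Y_{i'j'})=\Sigma_{jj'}\Psi_{ii'}$. For $R\in\mathbb R^{n\times p}$ put $G(R)=R(R^TR)^{-}R^T$, where ${}^{-}$ is the Moore--Penrose inverse. A level-$\alpha$ test is a measurable $\phi$ with values in $[0,1]$ whose expectation is at most $\alpha$ under every law of the null hypothesis; it is invariant under a group of transformations $g$ of the sample space if $\phi(g(Y))=\phi(Y)$ for all $g$ and $Y$. An invariant level-$\alpha$ test is uniformly most powerful (UMP) invariant if, under every law of the alternative, its expectation is at least that of any other invariant level-$\alpha$ test. (1) Mean-zero rank-1 spiked model. Let $1\le p<n$, let $c\in\mathbb R^n$ be a known unit vector, and let $Y\sim N_{n\times p}(0,\Sigma\otimes(\omega cc^T+I))$ with $\Sigma$ positive definite and $\omega\ge 0$ unknown. Let $U=Y(Y^TY)^{-1/2}$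 (with the Moore--Penrose inverse of the square root if $Y^TY$ is singular), so that $UU^T=G(Y)$, let $b\sim\mathrm{Beta}(p/2,(n-p)/2)$, and let $b_{1-\alpha}$ be the $(1-\alpha)$ quantile of this distribution. Then the test that rejects if and only if $c^TUU^Tc>b_{1-\alpha}$ is a UMP invariant level-$\alpha$ test of $H:\omega=0$ against $K:\omega>0$, where invariance is with respect to the transformations $Y\mapsto YA^T$, $A\in\mathbb R^{p\times p}$ nonsingular. Its rejection probability under $H$ is exactly $\alpha$ for every $\Sigma$, and for every $\Sigma$ and every $\omega\ge0$ its rejection probability is $$\Pr\Big(\frac{1+\omega}{1+b\omega}\,b>b_{1-\alpha}\Big)=\Pr\Big(b>\frac{b_{1-\alpha}}{1+\omega(1-b_{1-\alpha})}\Big).$$ (2) Regression model. Let $p\ge1$, $q\ge 0$, $p+q<n$, let $X\in\mathbb R^{n\times q}$ be a known matrix of rank $q$, let $P=I-X(X^TX)^{-1}X^T$, and let $c\in\mathbb R^n$ be a known unit vector with $Pc\ne0$. Let $Y\sim N_{n\times p}(XB^T,\Sigma\otimes(\omega cc^T+I))$ with $B\in\mathbb R^{p\times q}$ arbitrary, $\Sigma$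 positive definite and $\omega\ge0$, all unknown, and let $R=PY$. Now let $b\sim\mathrm{Beta}(p/2,(n-q-p)/2)$ and let $b_{1-\alpha}$ be the $(1-\alpha)$ quantile of this distribution. Then, for all $B$ and $\Sigma$, the statistic $c^TG(R)c/(c^TPc)$ has the distribution $\mathrm{Beta}(p/2,(n-q-p)/2)$ when $\omega=0$. The test that rejects if and only if $c^TG(R)c/(c^TPc)>b_{1-\alpha}$ is a UMP invariant level-$\alpha$ test of $H:\omega=0$ against $K:\omega>0$, where invariance is with respect to the transformations $Y\mapsto XC^T+YA^T$ with $C\in\mathbb R^{p\times q}$ and $A\in\mathbb R^{p\times p}$ nonsingular. For every $B$, $\Sigma$ and $\omega\ge0$ its rejection probability is $\Pr\big(b>b_{1-\alpha}/(1+\tilde\omega(1-b_{1-\alpha}))\big)$ with $\tilde\omega=\omega\,c^TPc$. -/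

import Mathlib

open MeasureTheory ProbabilityTheory Matrix
open scoped Kronecker

noncomputable section

namespace RowCov

/-- The Borel sigma-algebra on real matrices (the product sigma-algebra of the entries). -/
instance instMeasurableSpaceRealMatrix {m n : Type*} : MeasurableSpace (Matrix m n ℝ) :=
  inferInstanceAs (MeasurableSpace (m → n → ℝ))

/-- The matrix normal law `N_{n × p}(M, S ⊗ Ψ)`: the law of the random `n × p` matrix `Y` whose
entries are jointly Gaussian, `Y i j` having mean `M i j`, and `Y i j`, `Y i' j'` having covariance
`S j j' * Ψ i i'` (so `S` is the column covariance and `Ψ` the row covariance). -/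
def matrixNormal {n p : ℕ} (M : Matrix (Fin n) (Fin p) ℝ) (S : Matrix (Fin p) (Fin p) ℝ)
    (Ψ : Matrix (Fin n) (Fin n) ℝ) : Measure (Matrix (Fin n) (Fin p) ℝ) :=
  (multivariateGaussian
      (WithLp.toLp 2 (fun ji : Fin p × Fin n => M ji.2 ji.1)) (S ⊗ₖ Ψ)).map
    (fun y => Matrix.of fun i j => y (j, i))

/-- The Moore-Penrose inverse of a symmetric real matrix: invert the nonzero eigenvalues and keep
the zero ones (recall that `0⁻¹ = 0`). -/
def pinv {k : ℕ} (A : Matrix (Fin k) (Fin k) ℝ) : Matrix (Fin k) (Fin k) ℝ :=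
  cfc (fun x : ℝ => x⁻¹) A

/-- The Moore-Penrose inverse of the square root of a positive semidefinite matrix; it is
`A ^ (-1/2)` when `A` is positive definite. -/
def invSqrt {k : ℕ} (A : Matrix (Fin k) (Fin k) ℝ) : Matrix (Fin k) (Fin k) ℝ :=
  cfc (fun x : ℝ => (Real.sqrt x)⁻¹) A

/-- `U = Y (Yᵀ Y)^(-1/2)`. -/
def orthFactor {n p : ℕ} (Y : Matrix (Fin n) (Fin p) ℝ) : Matrix (Fin n) (Fin p) ℝ :=
  Y * invSqrt (Yᵀ * Y)

/-- `G(R) = R (Rᵀ R)⁻ Rᵀ`, the orthogonal projection onto the column space of `R`. -/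
def grass {n p : ℕ} (R : Matrix (Fin n) (Fin p) ℝ) : Matrix (Fin n) (Fin n) ℝ :=
  R * pinv (Rᵀ * R) * Rᵀ

/-- `P = I - X (Xᵀ X)⁻¹ Xᵀ`. -/
def residProj {n q : ℕ} (X : Matrix (Fin n) (Fin q) ℝ) : Matrix (Fin n) (Fin n) ℝ :=
  1 - X * (Xᵀ * X)⁻¹ * Xᵀ

/-- The rank-1 spiked row covariance `Ψ = ω c cᵀ + I`. -/
def spikedCov {n : ℕ} (c : Fin n → ℝ) (ω : ℝ) : Matrix (Fin n) (Fin n) ℝ :=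
  ω • vecMulVec c c + 1

/-- The laws `N(0, S ⊗ (ω c cᵀ + I))` with `S` positive definite and `ω` in `W`. -/
def meanZeroSpiked (p : ℕ) {n : ℕ} (c : Fin n → ℝ) (W : Set ℝ) :
    Set (Measure (Matrix (Fin n) (Fin p) ℝ)) :=
  {μ | ∃ (S : Matrix (Fin p) (Fin p) ℝ) (ω : ℝ), S.PosDef ∧ ω ∈ W ∧
    μ = matrixNormal 0 S (spikedCov c ω)}

/-- The laws `N(X Bᵀ, S ⊗ (ω c cᵀ + I))` with `B` arbitrary, `S` positive definite, `ω` in `W`. -/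
def regressionSpiked (p : ℕ) {n q : ℕ} (X : Matrix (Fin n) (Fin q) ℝ) (c : Fin n → ℝ)
    (W : Set ℝ) : Set (Measure (Matrix (Fin n) (Fin p) ℝ)) :=
  {μ | ∃ (B : Matrix (Fin p) (Fin q) ℝ) (S : Matrix (Fin p) (Fin p) ℝ) (ω : ℝ),
    S.PosDef ∧ ω ∈ W ∧ μ = matrixNormal (X * Bᵀ) S (spikedCov c ω)}

/-- The group of the transformations `Y ↦ Y Aᵀ`, `A` nonsingular. -/
def linearGroup (n p : ℕ) : Set (Matrix (Fin n) (Fin p) ℝ → Matrix (Fin n) (Fin p) ℝ) :=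
  {g | ∃ A : Matrix (Fin p) (Fin p) ℝ, IsUnit A.det ∧ g = fun Y => Y * Aᵀ}

/-- The group of the transformations `Y ↦ X Cᵀ + Y Aᵀ`, `A` nonsingular, `C` arbitrary. -/
def regressionGroup (p : ℕ) {n q : ℕ} (X : Matrix (Fin n) (Fin q) ℝ) :
    Set (Matrix (Fin n) (Fin p) ℝ → Matrix (Fin n) (Fin p) ℝ) :=
  {g | ∃ (C : Matrix (Fin p) (Fin q) ℝ) (A : Matrix (Fin p) (Fin p) ℝ),
    IsUnit A.det ∧ g = fun Y => X * Cᵀ + Y * Aᵀ}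

section Testing

variable {𝓨 : Type*} [MeasurableSpace 𝓨]

/-- An invariant level-`α` test of the null hypothesis `H` (a set of laws on the sample space):
a measurable (possibly randomized) test function `φ`, with `φ ∘ g = φ` for every `g` in `𝒢`, whose
rejection probability is at most `α` under every law in `H`. -/
structure IsInvariantLevelTest (𝒢 : Set (𝓨 → 𝓨)) (H : Set (Measure 𝓨)) (α : ℝ) (φ : 𝓨 → ℝ) :
    Prop where
  measurable : Measurable φ
  mem_Icc : ∀ y, φ y ∈ Set.Icc (0 : ℝ) 1
  invariant : ∀ g ∈ 𝒢, ∀ y, φ (g y) = φ y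
  level : ∀ μ ∈ H, ∫ y, φ y ∂μ ≤ α

/-- `φ` is a uniformly most powerful invariant level-`α` test of `H` versus `K`: it is an invariant
level-`α` test and, under each law in `K`, it is at least as powerful as any other such test. -/
structure IsUMPInvariantTest (𝒢 : Set (𝓨 → 𝓨)) (H K : Set (Measure 𝓨)) (α : ℝ) (φ : 𝓨 → ℝ) :
    Prop extends IsInvariantLevelTest 𝒢 H α φ where
  most_powerful : ∀ ψ : 𝓨 → ℝ, IsInvariantLevelTest 𝒢 H α ψ →
    ∀ μ ∈ K, ∫ y, ψ y ∂μ ≤ ∫ y, φ y ∂μ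

/-- The nonrandomized test that rejects exactly when `t y > k`. -/
def rejectAbove (t : 𝓨 → ℝ) (k : ℝ) : 𝓨 → ℝ :=
  Set.indicator {y | k < t y} (fun _ => 1)

end Testing

/-- The `u`-quantile of a law on the real line. -/
def quantile (μ : Measure ℝ) (u : ℝ) : ℝ :=
  sInf {x : ℝ | u ≤ μ.real (Set.Iic x)}

/-- `t_c(Y) = cᵀ U Uᵀ c`, where `U = Y (Yᵀ Y)^(-1/2)`. -/
def spikeStat (p : ℕ) {n : ℕ} (c : Fin n → ℝ) (Y : Matrix (Fin n) (Fin p) ℝ) : ℝ :=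
  c ⬝ᵥ ((orthFactor Y * (orthFactor Y)ᵀ) *ᵥ c)

/-- `cᵀ G(R) c / (cᵀ P c)`, where `R = P Y` is the matrix of least-squares residuals. -/
def residSpikeStat (p : ℕ) {n q : ℕ} (X : Matrix (Fin n) (Fin q) ℝ) (c : Fin n → ℝ)
    (Y : Matrix (Fin n) (Fin p) ℝ) : ℝ :=
  (c ⬝ᵥ (grass (residProj X * Y) *ᵥ c)) / (c ⬝ᵥ (residProj X *ᵥ c))

/-- `pinv` satisfies the four defining equations of the Moore-Penrose inverse. -/
theorem pinv_spec {k : ℕ} {A : Matrix (Fin k) (Fin k) ℝ} (hA : A.IsHermitian) :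
    A * pinv A * A = A ∧ pinv A * A * pinv A = pinv A ∧
      (A * pinv A)ᵀ = A * pinv A ∧ (pinv A * A)ᵀ = pinv A * A := by
  have hA' : IsSelfAdjoint A := hA
  have hc : ∀ f : ℝ → ℝ, ContinuousOn f (spectrum ℝ A) := fun f =>
    (Matrix.finite_real_spectrum (A := A)).continuousOn f
  have hid : cfc (fun x : ℝ => x) A = A := cfc_id' ℝ A
  have h1 : A * pinv A = cfc (fun x : ℝ => x * x⁻¹) A := by
    rw [pinv, cfc_mul (fun x : ℝ => x) (fun x : ℝ => x⁻¹) A (hc _) (hc _), hid]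
  have h2 : pinv A * A = cfc (fun x : ℝ => x⁻¹ * x) A := by
    rw [pinv, cfc_mul (fun x : ℝ => x⁻¹) (fun x : ℝ => x) A (hc _) (hc _), hid]
  have hs : ∀ f : ℝ → ℝ, (cfc f A)ᵀ = cfc f A := by
    intro f
    have h : IsSelfAdjoint (cfc f A) := cfc_predicate f A
    rw [← Matrix.conjTranspose_eq_transpose_of_trivial]
    exact h
  refine ⟨?_, ?_, by rw [h1, hs], by rw [h2, hs]⟩
  · have h3 : cfc (fun x : ℝ => x * x⁻¹) A * cfc (fun x : ℝ => x) A = cfc (fun x : ℝ => x) A := by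
      rw [← cfc_mul _ _ A (hc _) (hc _)]
      congr 1; funext x
      by_cases hx : x = 0 <;> simp [hx]
    rw [hid] at h3
    rw [h1, h3]
  · rw [h2, pinv, ← cfc_mul _ _ A (hc _) (hc _)]
    congr 1; funext x
    by_cases hx : x = 0 <;> simp [hx]

/-- `U Uᵀ = G(Y)`. -/
theorem orthFactor_mul_transpose {n p : ℕ} (Y : Matrix (Fin n) (Fin p) ℝ) :
    orthFactor Y * (orthFactor Y)ᵀ = grass Y := by
  have hpos : (Yᵀ * Y).PosSemidef := by
    have h := Matrix.posSemidef_conjTranspose_mul_self Y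
    rwa [Matrix.conjTranspose_eq_transpose_of_trivial] at h
  have hc : ∀ f : ℝ → ℝ, ContinuousOn f (spectrum ℝ (Yᵀ * Y)) := fun f =>
    (Matrix.finite_real_spectrum (A := Yᵀ * Y)).continuousOn f
  have hs : (invSqrt (Yᵀ * Y))ᵀ = invSqrt (Yᵀ * Y) := by
    have h : IsSelfAdjoint (invSqrt (Yᵀ * Y)) := cfc_predicate _ _
    rw [← Matrix.conjTranspose_eq_transpose_of_trivial]
    exact h
  have hm : invSqrt (Yᵀ * Y) * invSqrt (Yᵀ * Y) = pinv (Yᵀ * Y) := by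
    rw [invSqrt, pinv, ← cfc_mul _ _ _ (hc _) (hc _)]
    refine cfc_congr fun x hx => ?_
    rw [hpos.isHermitian.spectrum_real_eq_range_eigenvalues] at hx
    obtain ⟨i, rfl⟩ := hx
    have h0 := hpos.eigenvalues_nonneg i
    rw [← mul_inv, Real.mul_self_sqrt h0]
  rw [orthFactor, grass, Matrix.transpose_mul, hs, ← hm]
  simp only [Matrix.mul_assoc]

end RowCov

end

noncomputable section

open scoped ENNReal MatrixOrder

namespace RowCov

variable {m n p k : ℕ}

/-! Write `t = cᵀ G(Y) c`. If `S = TᵀT`, the mean-zero law with column covariance `S` is the image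
under `Y ↦ Y T` of the law with identity column covariance, so an invariant test does not see `S`
(`integral_matrixNormal_of_invariant`). It remains to compare the spiked law with the standard one
on functions invariant under right multiplication.

The likelihood ratio on these functions comes from `lintegral_invariant`. A double integral over `Y`
and a square matrix `A` is evaluated in both orders, which replaces the weight `exp(-|NY|²/2)` by
`(vol Y / vol NY)ⁿ exp(-|Y|²/2)`, with `vol Y = √det(YᵀY)`. For `N` the inverse square root of the
spiked covariance, the determinant lemma (`det_gram_mul`) gives the ratio `(1 - κ t)^(-n/2)` up to a
constant, with `κ = ω/(1+ω)`. It increases in `t` for every `ω > 0`, so by Neyman–Pearson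
(`integral_le_of_invariant_level`) one and the same test, rejecting for large `t`, is best against
all alternatives.

The null law of `t` (`lintegral_spikeStat`) is found by replacing `c` with the direction of an
independent Gaussian vector `g`, which the rotation invariance of `Y` allows. For fixed `Y` of full
rank, `t` becomes the share of `|g|²` carried by a `p`-dimensional subspace, which is beta. Under a
spike, two uses of the determinant lemma turn `t` into `(1+ω)t/(1+tω)` (`spikeStat_mul`), which
gives the power.

For regression, let the columns of `Q` be an orthonormal basis of the orthogonal complement of the
column space of `X`. Then `QᵀY` follows a mean-zero spiked model with `n - q` rows and spike `ω
cᵀPc`, and invariant tests depend on `Y` only through `QᵀY` (`exists_regression_reduction`). -/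

theorem measurable_matrix_iff {X : Type*} [MeasurableSpace X] {m n : Type*} {f : X → Matrix m n ℝ} :
    Measurable f ↔ ∀ i j, Measurable fun x => f x i j := by
  refine ⟨fun h i j => ?_, fun h => ?_⟩
  · exact (measurable_pi_apply j).comp ((measurable_pi_apply i).comp h)
  · exact measurable_pi_lambda _ fun i => measurable_pi_lambda _ fun j => h i j

theorem measurable_entry {m n : Type*} (i : m) (j : n) :
    Measurable fun Y : Matrix m n ℝ => Y i j :=
  measurable_matrix_iff.1 measurable_id i j

/-! ### Matrix normal laws and affine maps -/

/-- The matrix whose column-stacked vector is `y`. -/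
def unvec (y : Fin p × Fin n → ℝ) : Matrix (Fin n) (Fin p) ℝ := Matrix.of fun i j => y (j, i)

@[simp] theorem vec_unvec (y : Fin p × Fin n → ℝ) : vec (unvec y) = y := rfl

@[simp] theorem unvec_vec (Y : Matrix (Fin n) (Fin p) ℝ) : unvec (vec Y) = Y := rfl

theorem measurable_unvec : Measurable (unvec : _ → Matrix (Fin n) (Fin p) ℝ) :=
  measurable_matrix_iff.2 fun i j => measurable_pi_apply (j, i)

theorem measurable_vec : Measurable (vec : Matrix (Fin n) (Fin p) ℝ → _) :=
  measurable_pi_lambda _ fun ji => measurable_entry ji.2 ji.1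

theorem measurable_mul_mul {m n p k : ℕ} (L : Matrix (Fin m) (Fin n) ℝ)
    (R : Matrix (Fin p) (Fin k) ℝ) :
    Measurable fun Y : Matrix (Fin n) (Fin p) ℝ => L * Y * R := by
  refine measurable_matrix_iff.2 fun i j => ?_
  simp only [Matrix.mul_apply]
  fun_prop

theorem matrixNormal_eq (M : Matrix (Fin n) (Fin p) ℝ) (S : Matrix (Fin p) (Fin p) ℝ)
    (Ψ : Matrix (Fin n) (Fin n) ℝ) :
    matrixNormal M S Ψ =
      (multivariateGaussian (WithLp.toLp 2 (vec M)) (S ⊗ₖ Ψ)).map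
        (fun y => unvec (WithLp.ofLp y)) := rfl

theorem measurable_unvec_ofLp :
    Measurable fun y : EuclideanSpace ℝ (Fin p × Fin n) => unvec (WithLp.ofLp y) :=
  measurable_unvec.comp (by fun_prop)

instance (M : Matrix (Fin n) (Fin p) ℝ) (S : Matrix (Fin p) (Fin p) ℝ)
    (Ψ : Matrix (Fin n) (Fin n) ℝ) : IsProbabilityMeasure (matrixNormal M S Ψ) := by
  rw [matrixNormal_eq]
  exact Measure.isProbabilityMeasure_map measurable_unvec_ofLp.aemeasurable

/-- An affine image of a multivariate Gaussian law. -/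
theorem multivariateGaussian_map_affine {ι κ : Type*} [Fintype ι] [DecidableEq ι] [Fintype κ]
    [DecidableEq κ] (μ : EuclideanSpace ℝ ι) {S : Matrix ι ι ℝ} (hS : S.PosSemidef)
    (ν : EuclideanSpace ℝ κ) (A : Matrix κ ι ℝ) :
    (multivariateGaussian μ S).map (fun x => ν + WithLp.toLp 2 (A *ᵥ WithLp.ofLp x)) =
      multivariateGaussian (ν + WithLp.toLp 2 (A *ᵥ WithLp.ofLp μ)) (A * S * Aᵀ) := by
  have hm : Measurable fun x : EuclideanSpace ℝ ι => ν + WithLp.toLp 2 (A *ᵥ WithLp.ofLp x) := by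
    refine measurable_const.add ((WithLp.measurable_toLp 2 _).comp (measurable_pi_lambda _ fun i => ?_))
    simp only [Matrix.mulVec, dotProduct]
    fun_prop
  have := Measure.isProbabilityMeasure_map (μ := multivariateGaussian μ S) hm.aemeasurable
  have hAS : (A * S * Aᵀ).PosSemidef := by
    simpa using hS.mul_mul_conjTranspose_same A
  apply Measure.ext_of_charFun
  ext t
  -- The characteristic functions are compared: the adjoint moves `A` from the vector to the
  -- frequency.
  have key : ∀ x : EuclideanSpace ℝ ι,
      inner ℝ (ν + WithLp.toLp 2 (A *ᵥ WithLp.ofLp x)) t =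
        inner ℝ ν t + inner ℝ x (WithLp.toLp 2 (Aᵀ *ᵥ WithLp.ofLp t)) := by
    intro x
    rw [inner_add_left]
    congr 1
    simp only [PiLp.inner_apply, RCLike.inner_apply, conj_trivial]
    change (WithLp.ofLp t) ⬝ᵥ (A *ᵥ WithLp.ofLp x) = (Aᵀ *ᵥ WithLp.ofLp t) ⬝ᵥ (WithLp.ofLp x)
    rw [Matrix.dotProduct_mulVec, Matrix.mulVec_transpose]
  rw [charFun_apply, integral_map hm.aemeasurable (by fun_prop)]
  simp only [key]
  push_cast
  simp only [add_mul, Complex.exp_add]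
  rw [integral_const_mul, ← charFun_apply, charFun_multivariateGaussian hS,
    charFun_multivariateGaussian hAS, ← Complex.exp_add]
  congr 1
  rw [← add_sub_assoc, ← add_mul, real_inner_comm _ t, key μ, real_inner_comm μ]
  push_cast
  have h : (Aᵀ *ᵥ WithLp.ofLp t) ⬝ᵥ S *ᵥ (Aᵀ *ᵥ WithLp.ofLp t) =
      WithLp.ofLp t ⬝ᵥ (A * S * Aᵀ) *ᵥ WithLp.ofLp t := by
    rw [← Matrix.mulVec_mulVec, ← Matrix.mulVec_mulVec, Matrix.dotProduct_mulVec (WithLp.ofLp t),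
      Matrix.mulVec_transpose]
  rw [h]

/-- Column stacking turns `Y ↦ L Y Rᵀ` into the linear map `R ⊗ L`, and the mixed-product rule
splits the new covariance into its two Kronecker factors. -/
theorem matrixNormal_map_affine (M : Matrix (Fin n) (Fin p) ℝ) {S : Matrix (Fin p) (Fin p) ℝ}
    {Ψ : Matrix (Fin n) (Fin n) ℝ} (hS : S.PosSemidef) (hΨ : Ψ.PosSemidef)
    (M' : Matrix (Fin m) (Fin k) ℝ) (L : Matrix (Fin m) (Fin n) ℝ) (R : Matrix (Fin k) (Fin p) ℝ) :
    (matrixNormal M S Ψ).map (fun Y => M' + L * Y * Rᵀ) =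
      matrixNormal (M' + L * M * Rᵀ) (R * S * Rᵀ) (L * Ψ * Lᵀ) := by
  have hmm : Measurable fun Y : Matrix (Fin n) (Fin p) ℝ => M' + L * Y * Rᵀ := by
    refine measurable_matrix_iff.2 fun i j => ?_
    exact (measurable_matrix_iff.1 (measurable_mul_mul L Rᵀ) i j).const_add _
  have h1 : vec (M' + L * M * Rᵀ) = vec M' + (R ⊗ₖ L) *ᵥ vec M := by
    rw [Matrix.kronecker_mulVec_vec, vec_add]
  have h2 : (R * S * Rᵀ) ⊗ₖ (L * Ψ * Lᵀ) = (R ⊗ₖ L) * (S ⊗ₖ Ψ) * (R ⊗ₖ L)ᵀ := by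
    rw [← Matrix.kroneckerMap_transpose, ← Matrix.mul_kronecker_mul, ← Matrix.mul_kronecker_mul]
  rw [matrixNormal_eq, matrixNormal_eq, Measure.map_map hmm measurable_unvec_ofLp, h1, h2,
    WithLp.toLp_add, ← multivariateGaussian_map_affine _ (hS.kronecker hΨ), Measure.map_map
    measurable_unvec_ofLp]
  · congr 1
    funext y
    apply Matrix.vec_bijective.1
    simp [vec_add, ← Matrix.kronecker_mulVec_vec]
  · refine measurable_const.add ((WithLp.measurable_toLp 2 _).comp (measurable_pi_lambda _ fun i => ?_))
    simp only [Matrix.mulVec, dotProduct]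
    fun_prop

/-! ### Lebesgue measure and Gaussian density on matrices -/

/-- The standard Gaussian law on `ℝ^ι` has density `(2π)^(-|ι|/2) exp (-|x|² / 2)`. -/
theorem pi_gaussianReal_eq_withDensity (ι : Type*) [Fintype ι] :
    Measure.pi (fun _ : ι => gaussianReal 0 1) =
      (volume : Measure (ι → ℝ)).withDensity fun x =>
        ENNReal.ofReal ((√(2 * Real.pi))⁻¹ ^ Fintype.card ι * Real.exp (-(x ⬝ᵥ x) / 2)) := by
  symm
  have hprod : ∀ x : ι → ℝ, (√(2 * Real.pi))⁻¹ ^ Fintype.card ι * Real.exp (-(x ⬝ᵥ x) / 2) =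
      ∏ i, gaussianPDFReal 0 1 (x i) := by
    intro x
    simp only [gaussianPDFReal, Finset.prod_mul_distrib, Finset.prod_const, NNReal.coe_one, mul_one,
      sub_zero, ← Real.exp_sum, Finset.card_univ, dotProduct, ← Finset.sum_div,
      Finset.sum_neg_distrib, pow_two]
  simp only [hprod]
  symm
  refine Measure.pi_eq fun s hs => ?_
  have hint : ∀ i, Integrable (gaussianPDFReal 0 1) (volume.restrict (s i)) := fun i =>
    (integrable_gaussianPDFReal 0 1).restrict
  rw [withDensity_apply _ (MeasurableSet.univ_pi hs), volume_pi, Measure.restrict_pi_pi,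
    ← ofReal_integral_eq_lintegral_ofReal (Integrable.fintype_prod hint)
      (ae_of_all _ fun x => Finset.prod_nonneg fun i _ => gaussianPDFReal_nonneg 0 1 _),
    integral_fintype_prod_eq_prod,
    ENNReal.ofReal_prod_of_nonneg fun i _ => integral_nonneg fun x => gaussianPDFReal_nonneg 0 1 x]
  refine Finset.prod_congr rfl fun i _ => ?_
  rw [ofReal_integral_eq_lintegral_ofReal (hint i)
    (ae_of_all _ fun x => gaussianPDFReal_nonneg 0 1 x), gaussianReal_of_var_ne_zero _ one_ne_zero,
    withDensity_apply _ (hs i)]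
  rfl

/-- Lebesgue measure on the real `n × p` matrices. -/
def matrixVolume (n p : ℕ) : Measure (Matrix (Fin n) (Fin p) ℝ) :=
  (volume : Measure (Fin p × Fin n → ℝ)).map unvec

/-- Column stacking as a measurable equivalence. -/
def unvecEquiv : (Fin p × Fin n → ℝ) ≃ᵐ Matrix (Fin n) (Fin p) ℝ where
  toFun := unvec
  invFun := vec
  left_inv _ := rfl
  right_inv _ := rfl
  measurable_toFun := measurable_unvec
  measurable_invFun := measurable_vec

theorem lintegral_matrixVolume (F : Matrix (Fin n) (Fin p) ℝ → ℝ≥0∞) :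
    ∫⁻ Y, F Y ∂matrixVolume n p = ∫⁻ y : Fin p × Fin n → ℝ, F (unvec y) :=
  lintegral_map_equiv F unvecEquiv

instance : SigmaFinite (matrixVolume n p) :=
  unvecEquiv.sigmaFinite_map

theorem ae_matrixVolume_iff {P : Matrix (Fin n) (Fin p) ℝ → Prop} :
    (∀ᵐ Y ∂matrixVolume n p, P Y) ↔ ∀ᵐ y : Fin p × Fin n → ℝ, P (unvec y) := by
  have h := (unvecEquiv (n := n) (p := p)).measurableEmbedding.ae_map_iff (μ := volume) (p := P)
  exact h

/-- `exp (-tr(YᵀY) / 2)`, the unnormalized standard Gaussian density. -/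
def gaussWeight (Y : Matrix (Fin n) (Fin p) ℝ) : ℝ≥0∞ :=
  ENNReal.ofReal (Real.exp (-(Yᵀ * Y).trace / 2))

theorem measurable_gram_entry (i j : Fin p) :
    Measurable fun Y : Matrix (Fin n) (Fin p) ℝ => (Yᵀ * Y) i j := by
  simp only [Matrix.mul_apply, Matrix.transpose_apply]
  exact Finset.measurable_sum _ fun k _ => (measurable_entry k i).mul (measurable_entry k j)

theorem measurable_det {X : Type*} [MeasurableSpace X] {f : X → Matrix (Fin p) (Fin p) ℝ}
    (hf : ∀ i j, Measurable fun x => f x i j) : Measurable fun x => (f x).det := by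
  simp only [Matrix.det_apply]
  refine Finset.measurable_sum _ fun σ _ => ?_
  exact (Finset.measurable_prod _ fun i _ => hf (σ i) i).const_smul _

theorem measurable_gaussWeight :
    Measurable (gaussWeight : Matrix (Fin n) (Fin p) ℝ → ℝ≥0∞) := by
  refine ENNReal.measurable_ofReal.comp (Real.measurable_exp.comp (Measurable.div_const ?_ _))
  refine Measurable.neg ?_
  simp only [Matrix.trace, Matrix.diag]
  exact Finset.measurable_sum _ fun i _ => measurable_gram_entry i i

/-- Integrals against the standard matrix normal law. -/
theorem exists_lintegral_matrixNormal_one (n p : ℕ) :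
    ∃ c : ℝ≥0∞, c ≠ 0 ∧ c ≠ ∞ ∧ ∀ F : Matrix (Fin n) (Fin p) ℝ → ℝ≥0∞, Measurable F →
      ∫⁻ Y, F Y ∂matrixNormal 0 1 1 = c * ∫⁻ Y, F Y * gaussWeight Y ∂matrixVolume n p := by
  refine ⟨ENNReal.ofReal ((√(2 * Real.pi))⁻¹ ^ Fintype.card (Fin p × Fin n)), ?_,
    ENNReal.ofReal_ne_top, fun F hF => ?_⟩
  · rw [Ne, ENNReal.ofReal_eq_zero, not_le]
    positivity
  · have h0 : matrixNormal (0 : Matrix (Fin n) (Fin p) ℝ) 1 1 =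
        (Measure.pi fun _ : Fin p × Fin n => gaussianReal 0 1).map unvec := by
      rw [matrixNormal_eq, Matrix.one_kronecker_one, Matrix.vec_zero, WithLp.toLp_zero,
        multivariateGaussian_zero_one, ← map_pi_eq_stdGaussian,
        Measure.map_map measurable_unvec_ofLp (WithLp.measurable_toLp 2 _)]
      rfl
    rw [h0, lintegral_map hF measurable_unvec, pi_gaussianReal_eq_withDensity,
      lintegral_withDensity_eq_lintegral_mul₀, lintegral_matrixVolume, ← lintegral_const_mul]
    · refine lintegral_congr fun y => ?_
      rw [Pi.mul_apply, ENNReal.ofReal_mul (by positivity), gaussWeight, ← vec_dotProduct_vec,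
        vec_unvec, mul_assoc, mul_comm (F _)]
    · exact (hF.mul measurable_gaussWeight).comp measurable_unvec
    · refine (ENNReal.measurable_ofReal.comp ?_).aemeasurable
      simp only [dotProduct]
      fun_prop
    · exact (hF.comp measurable_unvec).aemeasurable

/-- The change of variables `Y ↦ L Y R`. -/
theorem lintegral_matrixVolume_mul_mul {L : Matrix (Fin n) (Fin n) ℝ} {R : Matrix (Fin p) (Fin p) ℝ}
    (hL : L.det ≠ 0) (hR : R.det ≠ 0) {F : Matrix (Fin n) (Fin p) ℝ → ℝ≥0∞} (hF : Measurable F) :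
    ∫⁻ Y, F Y ∂matrixVolume n p =
      ENNReal.ofReal (|L.det| ^ p * |R.det| ^ n) * ∫⁻ Y, F (L * Y * R) ∂matrixVolume n p := by
  have hdet : (Rᵀ ⊗ₖ L).det = R.det ^ n * L.det ^ p := by
    rw [Matrix.det_kronecker, Matrix.det_transpose]; simp
  have hne : (Rᵀ ⊗ₖ L).det ≠ 0 := by rw [hdet]; positivity
  have hmap := Real.map_matrix_volume_pi_eq_smul_volume_pi hne
  have habs : |L.det| ^ p * |R.det| ^ n = |(Rᵀ ⊗ₖ L).det| := by
    rw [hdet, abs_mul, abs_pow, abs_pow, mul_comm]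
  have hT : Measurable (Matrix.toLin' (Rᵀ ⊗ₖ L)) :=
    (Matrix.toLin' (Rᵀ ⊗ₖ L)).continuous_of_finiteDimensional.measurable
  have h1 : ∫⁻ Y, F (L * Y * R) ∂matrixVolume n p =
      ∫⁻ y, F (unvec y) ∂(Measure.map (Matrix.toLin' (Rᵀ ⊗ₖ L)) volume) := by
    rw [lintegral_map (f := fun y => F (unvec y)) (hF.comp measurable_unvec) hT, lintegral_matrixVolume]
    refine lintegral_congr fun y => ?_
    congr 1
    apply Matrix.vec_bijective.1
    rw [vec_unvec, Matrix.toLin'_apply]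
    nth_rw 2 [← vec_unvec y]
    rw [Matrix.kronecker_mulVec_vec, Matrix.transpose_transpose]
  rw [h1, hmap, lintegral_smul_measure, smul_eq_mul, ← mul_assoc, habs,
    ← ENNReal.ofReal_mul (abs_nonneg _), ← abs_mul, mul_inv_cancel₀ hne, abs_one,
    ENNReal.ofReal_one, one_mul, lintegral_matrixVolume]

/-! ### Full column rank and the projection onto the column space -/

theorem det_gram_ne_zero_iff {Y : Matrix (Fin n) (Fin p) ℝ} :
    (Yᵀ * Y).det ≠ 0 ↔ ∀ v, Y *ᵥ v = 0 → v = 0 := by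
  rw [Ne, ← Matrix.exists_mulVec_eq_zero_iff]
  push Not
  refine ⟨fun h v hv => ?_, fun h v hv hYv => hv (h v ?_)⟩
  · by_contra h0
    exact h v h0 (by rw [← Matrix.mulVec_mulVec, hv, Matrix.mulVec_zero])
  · have h2 : (Y *ᵥ v) ⬝ᵥ (Y *ᵥ v) = 0 := by
      rw [Matrix.dotProduct_mulVec, ← Matrix.mulVec_transpose, Matrix.mulVec_mulVec, hYv,
        zero_dotProduct]
    exact dotProduct_self_eq_zero.1 h2

/-- Almost every `n × p` matrix with `p ≤ n` has full column rank. -/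
theorem ae_det_gram_ne_zero (h : p ≤ n) :
    ∀ᵐ Y ∂matrixVolume n p, (Yᵀ * Y).det ≠ 0 := by
  let E : Matrix (Fin n) (Fin p) ℝ := Matrix.of fun i j => if i = Fin.castLE h j then 1 else 0
  have hE : Eᵀ * E = 1 := by
    ext i j
    rw [Matrix.mul_apply, Finset.sum_eq_single (Fin.castLE h i)]
    · simp [E, Matrix.one_apply]
    · intro x _ hx
      simp [E, hx]
    · simp
  have hsub : ∀ᵐ Y ∂matrixVolume n p, (Eᵀ * Y).det ≠ 0 := by
    rw [ae_matrixVolume_iff]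
    have hm : Measurable fun z : (Fin p × Fin n → ℝ) × ℝ => (Eᵀ * unvec (z.1 + z.2 • vec E)).det := by
      refine measurable_det fun i j => ?_
      simp only [Matrix.mul_apply, unvec, Matrix.of_apply, Pi.add_apply, Pi.smul_apply]
      fun_prop
    have hms : MeasurableSet {z : (Fin p × Fin n → ℝ) × ℝ |
        (Eᵀ * unvec (z.1 + z.2 • vec E)).det ≠ 0} := hm (measurableSet_singleton 0).compl
    -- Along the line `Y + tE` the minor is the characteristic polynomial of `-EᵀY` at `t`, because
    -- `EᵀE = 1`; it has finitely many roots.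
    have hfin : ∀ y : Fin p × Fin n → ℝ, ∀ᵐ t : ℝ, (Eᵀ * unvec (y + t • vec E)).det ≠ 0 := by
      intro y
      have : {t : ℝ | ¬ (Eᵀ * unvec (y + t • vec E)).det ≠ 0} ⊆
          {t | (-(Eᵀ * unvec y)).charpoly.IsRoot t} := by
        intro t ht
        simp only [ne_eq, not_not, Set.mem_ofPred_eq] at ht
        rw [Set.mem_ofPred_eq, Polynomial.IsRoot, Matrix.eval_charpoly, ← ht]
        congr 1
        have : unvec (y + t • vec E) = unvec y + t • E := rfl
        rw [this, Matrix.mul_add, Matrix.mul_smul, hE, sub_neg_eq_add, add_comm,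
          Matrix.scalar_apply, Matrix.smul_one_eq_diagonal]
      refine measure_mono_null this (Set.Finite.measure_zero ?_ _)
      exact Polynomial.finite_setOfPred_isRoot (Matrix.charpoly_monic _).ne_zero
    -- By Fubini a single `t` works for almost every `y`; translation invariance then removes the
    -- shift.
    have hswap : ∀ᵐ t : ℝ, ∀ᵐ y : Fin p × Fin n → ℝ, (Eᵀ * unvec (y + t • vec E)).det ≠ 0 :=
      (Measure.ae_ae_comm (μ := volume) (ν := volume)
        (p := fun (y : Fin p × Fin n → ℝ) (t : ℝ) => (Eᵀ * unvec (y + t • vec E)).det ≠ 0) hms).1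
        (ae_of_all _ hfin)
    obtain ⟨t, ht⟩ := hswap.exists
    have := (measurePreserving_add_right (volume : Measure (Fin p × Fin n → ℝ))
      (-(t • vec E))).quasiMeasurePreserving.ae ht
    simpa [add_assoc] using this
  filter_upwards [hsub] with Y hY
  refine det_gram_ne_zero_iff.2 fun v hv => ?_
  by_contra hv0
  exact hY (Matrix.exists_mulVec_eq_zero_iff.1
    ⟨v, hv0, by rw [← Matrix.mulVec_mulVec, hv, Matrix.mulVec_zero]⟩)

theorem isHermitian_gram (Y : Matrix (Fin n) (Fin p) ℝ) : (Yᵀ * Y).IsHermitian := by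
  simpa using Matrix.isHermitian_conjTranspose_mul_self Y

theorem pinv_transpose (A : Matrix (Fin k) (Fin k) ℝ) : (pinv A)ᵀ = pinv A := by
  have h : IsSelfAdjoint (pinv A) := cfc_predicate _ _
  rw [← Matrix.conjTranspose_eq_transpose_of_trivial]
  exact h

theorem eq_zero_of_transpose_mul_self {Z : Matrix (Fin n) (Fin p) ℝ} (h : Zᵀ * Z = 0) : Z = 0 := by
  rw [← Matrix.conjTranspose_eq_transpose_of_trivial] at h
  exact Matrix.conjTranspose_mul_self_eq_zero.1 h

theorem grass_transpose (Y : Matrix (Fin n) (Fin p) ℝ) : (grass Y)ᵀ = grass Y := by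
  simp [grass, Matrix.transpose_mul, pinv_transpose, Matrix.mul_assoc]

/-- The difference `Z = Y - G(Y)Y` satisfies `YᵀZ = 0` by the first Moore–Penrose equation, hence
`ZᵀZ = 0`. No rank assumption is needed. -/
theorem grass_mul_self (Y : Matrix (Fin n) (Fin p) ℝ) : grass Y * Y = Y := by
  obtain ⟨h1, -, -, -⟩ := pinv_spec (isHermitian_gram Y)
  have h : Y - grass Y * Y = 0 := by
    apply eq_zero_of_transpose_mul_self
    have h2 : Yᵀ * (grass Y * Y) = Yᵀ * Y := by
      rw [grass]; simpa only [Matrix.mul_assoc] using h1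
    have h3 : Yᵀ * (Y - grass Y * Y) = 0 := by rw [Matrix.mul_sub, h2, sub_self]
    rw [Matrix.transpose_sub, Matrix.transpose_mul, grass_transpose, Matrix.sub_mul, h3,
      Matrix.mul_assoc, grass, Matrix.mul_assoc, Matrix.mul_assoc, ← grass, h3]
    simp
  exact (sub_eq_zero.1 h).symm

/-- `grass Y` is the only symmetric matrix that fixes `Y` and factors through `Y`. -/
theorem eq_grass {Y : Matrix (Fin n) (Fin p) ℝ} {G : Matrix (Fin n) (Fin n) ℝ}
    {K : Matrix (Fin p) (Fin n) ℝ} (hG : Gᵀ = G) (hGY : G * Y = Y) (hK : G = Y * K) :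
    G = grass Y := by
  have h1 : grass Y * G = G := by rw [hK, ← Matrix.mul_assoc, grass_mul_self]
  have h2 : G * grass Y = grass Y := by
    rw [grass, ← Matrix.mul_assoc, ← Matrix.mul_assoc, hGY]
  have h3 := congrArg Matrix.transpose h1
  rw [Matrix.transpose_mul, hG, grass_transpose, h2] at h3
  exact h3.symm

theorem grass_mul_grass (Y : Matrix (Fin n) (Fin p) ℝ) : grass Y * grass Y = grass Y := by
  nth_rw 2 [grass]
  rw [← Matrix.mul_assoc, ← Matrix.mul_assoc, grass_mul_self, grass]

/-- `Y` and `YA` have the same column space. This is what makes the spike statistic invariant. -/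
theorem grass_mul_right (Y : Matrix (Fin n) (Fin p) ℝ) {A : Matrix (Fin p) (Fin p) ℝ}
    (hA : IsUnit A.det) : grass (Y * A) = grass Y := by
  refine eq_grass (K := A * pinv ((Y * A)ᵀ * (Y * A)) * (Y * A)ᵀ) (grass_transpose _) ?_ ?_
  · have h := congrArg (· * A⁻¹) (grass_mul_self (Y * A))
    simpa only [Matrix.mul_assoc, Matrix.mul_nonsing_inv A hA, Matrix.mul_one] using h
  · rw [grass]; simp only [Matrix.mul_assoc]

theorem grass_orthogonal_mul {Q : Matrix (Fin m) (Fin n) ℝ} (hQ : Qᵀ * Q = 1)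
    (W : Matrix (Fin n) (Fin p) ℝ) : grass (Q * W) = Q * grass W * Qᵀ := by
  have h : (Q * W)ᵀ * (Q * W) = Wᵀ * W := by
    rw [Matrix.transpose_mul, Matrix.mul_assoc, ← Matrix.mul_assoc Qᵀ, hQ, Matrix.one_mul]
  rw [grass, h, grass, Matrix.transpose_mul]
  simp only [Matrix.mul_assoc]

theorem grass_of_det_ne_zero {Y : Matrix (Fin n) (Fin p) ℝ} (h : (Yᵀ * Y).det ≠ 0) :
    grass Y = Y * (Yᵀ * Y)⁻¹ * Yᵀ := by
  symm
  have hu : IsUnit (Yᵀ * Y).det := isUnit_iff_ne_zero.2 h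
  refine eq_grass (K := (Yᵀ * Y)⁻¹ * Yᵀ) ?_ ?_ (by rw [Matrix.mul_assoc])
  · simp [Matrix.transpose_mul, Matrix.transpose_nonsing_inv, Matrix.mul_assoc]
  · rw [Matrix.mul_assoc, Matrix.mul_assoc, Matrix.nonsing_inv_mul _ hu, Matrix.mul_one]

theorem trace_grass {Y : Matrix (Fin n) (Fin p) ℝ} (h : (Yᵀ * Y).det ≠ 0) :
    (grass Y).trace = p := by
  rw [grass_of_det_ne_zero h, Matrix.mul_assoc, Matrix.trace_mul_comm, Matrix.mul_assoc,
    Matrix.nonsing_inv_mul _ (isUnit_iff_ne_zero.2 h), Matrix.trace_one, Fintype.card_fin]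

theorem dotProduct_mulVec_self_of_idempotent {P : Matrix (Fin n) (Fin n) ℝ} (h1 : Pᵀ = P)
    (h2 : P * P = P) (c : Fin n → ℝ) : (P *ᵥ c) ⬝ᵥ (P *ᵥ c) = c ⬝ᵥ (P *ᵥ c) := by
  rw [Matrix.dotProduct_mulVec, ← Matrix.mulVec_transpose, h1, Matrix.mulVec_mulVec, h2,
    dotProduct_comm]

theorem dotProduct_mulVec_mem_Icc_of_idempotent {P : Matrix (Fin n) (Fin n) ℝ} (h1 : Pᵀ = P)
    (h2 : P * P = P) {c : Fin n → ℝ} (hc : c ⬝ᵥ c = 1) : c ⬝ᵥ (P *ᵥ c) ∈ Set.Icc (0 : ℝ) 1 := by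
  constructor
  · rw [← dotProduct_mulVec_self_of_idempotent h1 h2]
    exact Finset.sum_nonneg fun i _ => mul_self_nonneg _
  · have h := dotProduct_mulVec_self_of_idempotent (P := 1 - P)
      (by rw [Matrix.transpose_sub, h1, Matrix.transpose_one])
      (by rw [Matrix.mul_sub, Matrix.sub_mul, Matrix.sub_mul, h2]; simp) c
    rw [Matrix.sub_mulVec, Matrix.one_mulVec, dotProduct_sub c, hc] at h
    have : 0 ≤ (c - P *ᵥ c) ⬝ᵥ (c - P *ᵥ c) := Finset.sum_nonneg fun i _ => mul_self_nonneg _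
    linarith

theorem spikeStat_eq (c : Fin n → ℝ) (Y : Matrix (Fin n) (Fin p) ℝ) :
    spikeStat p c Y = c ⬝ᵥ (grass Y *ᵥ c) := by
  rw [spikeStat, orthFactor_mul_transpose]

theorem spikeStat_mem_Icc {c : Fin n → ℝ} (hc : c ⬝ᵥ c = 1) (Y : Matrix (Fin n) (Fin p) ℝ) :
    spikeStat p c Y ∈ Set.Icc (0 : ℝ) 1 := by
  rw [spikeStat_eq]
  exact dotProduct_mulVec_mem_Icc_of_idempotent (grass_transpose Y) (grass_mul_grass Y) hc

/-- The effect on the Gram determinant of a rank-one change of the row metric. -/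
theorem det_gram_mul {N : Matrix (Fin n) (Fin n) ℝ} {a : ℝ} {c : Fin n → ℝ}
    (hN : Nᵀ * N = a • vecMulVec c c + 1) {Y : Matrix (Fin n) (Fin p) ℝ}
    (h : (Yᵀ * Y).det ≠ 0) :
    ((N * Y)ᵀ * (N * Y)).det = (Yᵀ * Y).det * (1 + a * spikeStat p c Y) := by
  have hu : IsUnit (Yᵀ * Y).det := isUnit_iff_ne_zero.2 h
  -- The Gram matrix changes by a rank-one term in `Yᵀc`, so the matrix determinant lemma applies;
  -- its scalar `(Yᵀc)ᵀ(YᵀY)⁻¹(Yᵀc)` is the spike statistic.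
  have h1 : (N * Y)ᵀ * (N * Y) = Yᵀ * Y +
      (a • replicateCol Unit (Yᵀ *ᵥ c)) * replicateRow Unit (Yᵀ *ᵥ c) := by
    rw [Matrix.transpose_mul, Matrix.mul_assoc, ← Matrix.mul_assoc Nᵀ, hN, Matrix.add_mul,
      Matrix.one_mul, Matrix.mul_add, add_comm, Matrix.smul_mul, Matrix.mul_smul, Matrix.smul_mul,
      ← Matrix.vecMulVec_eq, Matrix.vecMulVec_mul, Matrix.mul_vecMulVec, Matrix.mulVec_transpose]
  rw [h1, Matrix.det_add_mul _ _ hu, Matrix.det_unique (n := Unit), Matrix.add_apply,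
    Matrix.one_apply_eq,
    Matrix.mul_smul, Matrix.smul_apply, smul_eq_mul, spikeStat_eq, grass_of_det_ne_zero h]
  congr 3
  rw [Matrix.mul_assoc, ← Matrix.replicateCol_mulVec, Matrix.replicateRow_mul_replicateCol_apply,
    ← Matrix.mulVec_mulVec, ← Matrix.mulVec_mulVec, Matrix.dotProduct_mulVec c, Matrix.mulVec_transpose]

/-! ### Measurability and diagonalization of the projection -/

/-- The Moore-Penrose inverse is a limit of regularized inverses. -/
theorem tendsto_resolvent_pinv {A : Matrix (Fin k) (Fin k) ℝ} (hA : A.PosSemidef) (i j : Fin k) :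
    Filter.Tendsto (fun l : ℕ => ((A * A + ((l : ℝ) + 1)⁻¹ • 1)⁻¹ * A) i j) Filter.atTop
      (nhds (pinv A i j)) := by
  have hA' : IsSelfAdjoint A := hA.isHermitian
  have hc : ∀ f : ℝ → ℝ, ContinuousOn f (spectrum ℝ A) := fun f =>
    (Matrix.finite_real_spectrum (A := A)).continuousOn f
  have hid : cfc (fun x : ℝ => x) A = A := cfc_id' ℝ A
  have hentry : ∀ f : ℝ → ℝ, cfc f A i j = ∑ l, hA.isHermitian.eigenvectorUnitary.1 i l *
      f (hA.isHermitian.eigenvalues l) * hA.isHermitian.eigenvectorUnitary.1 j l := by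
    intro f
    rw [hA.isHermitian.cfc_eq, Matrix.IsHermitian.cfc, Unitary.conjStarAlgAut_apply, Matrix.mul_apply]
    refine Finset.sum_congr rfl fun l _ => ?_
    rw [Matrix.mul_diagonal]
    simp [Matrix.star_apply]
  have hres : ∀ l : ℕ, (A * A + ((l : ℝ) + 1)⁻¹ • 1)⁻¹ * A =
      cfc (fun x : ℝ => (x * x + ((l : ℝ) + 1)⁻¹)⁻¹ * x) A := by
    intro l
    have hpos : (0 : ℝ) < ((l : ℝ) + 1)⁻¹ := by positivity
    have h1 : A * A + ((l : ℝ) + 1)⁻¹ • 1 = cfc (fun x : ℝ => x * x + ((l : ℝ) + 1)⁻¹) A := by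
      rw [cfc_add _ _ _ (hc _) (hc _), cfc_mul _ _ _ (hc _) (hc _), hid, cfc_const _ A,
        Algebra.algebraMap_eq_smul_one]
    have h2 : cfc (fun x : ℝ => (x * x + ((l : ℝ) + 1)⁻¹)⁻¹) A * (A * A + ((l : ℝ) + 1)⁻¹ • 1) = 1 := by
      rw [h1, ← cfc_mul _ _ _ (hc _) (hc _), ← cfc_const_one ℝ A]
      refine cfc_congr fun x _ => ?_
      exact inv_mul_cancel₀ (by have := mul_self_nonneg x; positivity)
    rw [Matrix.inv_eq_left_inv h2, cfc_mul _ _ _ (hc _) (hc _), hid]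
  simp only [hres, pinv, hentry]
  refine tendsto_finsetSum _ fun l _ => (Filter.Tendsto.const_mul _ ?_).mul_const _
  set x := hA.isHermitian.eigenvalues l
  have h0 : Filter.Tendsto (fun l : ℕ => ((l : ℝ) + 1)⁻¹) Filter.atTop (nhds 0) := by
    simpa using tendsto_one_div_add_atTop_nhds_zero_nat (𝕜 := ℝ)
  -- At a zero eigenvalue every term of the sequence is already `0`, the value given by `0⁻¹ = 0`.
  by_cases hx : x = 0
  · simp [hx]
  · have h1 := ((h0.const_add (x * x)).inv₀ (by simpa using hx)).mul_const x
    have h2 : (x * x + 0)⁻¹ * x = x⁻¹ := by field_simp; simp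
    rwa [h2] at h1

/-- The Moore–Penrose inverse jumps where the rank drops, so continuity is unavailable. It is a
pointwise limit of regularized inverses, whose entries are rational functions of `Y`. -/
theorem measurable_grass : Measurable (grass : Matrix (Fin n) (Fin p) ℝ → _) := by
  have hpinv : ∀ i j, Measurable fun Y : Matrix (Fin n) (Fin p) ℝ => pinv (Yᵀ * Y) i j := by
    intro i j
    refine measurable_of_tendsto_metrizable (f := fun (l : ℕ) (Y : Matrix (Fin n) (Fin p) ℝ) =>
      (((Yᵀ * Y) * (Yᵀ * Y) + ((l : ℝ) + 1)⁻¹ • (1 : Matrix (Fin p) (Fin p) ℝ))⁻¹ * (Yᵀ * Y)) i j)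
      (fun l => ?_) ?_
    · have hB : ∀ i j, Measurable fun Y : Matrix (Fin n) (Fin p) ℝ =>
          ((Yᵀ * Y) * (Yᵀ * Y) + ((l : ℝ) + 1)⁻¹ • (1 : Matrix (Fin p) (Fin p) ℝ)) i j := by
        intro i j
        refine Measurable.add_const ?_ _
        simp only [Matrix.mul_apply (M := _ᵀ * _)]
        exact Finset.measurable_sum _ fun r _ => (measurable_gram_entry i r).mul
          (measurable_gram_entry r j)
      rw [show (fun Y : Matrix (Fin n) (Fin p) ℝ => (((Yᵀ * Y) * (Yᵀ * Y) +
        ((l : ℝ) + 1)⁻¹ • (1 : Matrix (Fin p) (Fin p) ℝ))⁻¹ * (Yᵀ * Y)) i j) = fun Y => ∑ r,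
        ((Yᵀ * Y) * (Yᵀ * Y) + ((l : ℝ) + 1)⁻¹ • (1 : Matrix (Fin p) (Fin p) ℝ))⁻¹ i r *
          (Yᵀ * Y) r j from rfl]
      refine Finset.measurable_sum _ fun r _ => Measurable.mul ?_ (measurable_gram_entry r j)
      simp only [Matrix.inv_def, Matrix.smul_apply, Ring.inverse_eq_inv', smul_eq_mul,
        Matrix.adjugate_apply]
      refine (measurable_det hB).inv.mul (measurable_det fun a b => ?_)
      simp only [Matrix.updateRow_apply]
      split_ifs
      · exact measurable_const
      · exact hB a b
    · rw [tendsto_pi_nhds]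
      intro Y
      exact tendsto_resolvent_pinv (by simpa using Matrix.posSemidef_conjTranspose_mul_self Y) i j
  refine measurable_matrix_iff.2 fun i j => ?_
  simp only [grass, Matrix.mul_apply, Matrix.transpose_apply]
  refine Finset.measurable_sum _ fun a _ => Measurable.mul (Finset.measurable_sum _ fun b _ => ?_)
    (measurable_entry _ _)
  exact (measurable_entry _ _).mul (hpinv _ _)

theorem measurable_dotProduct_grass (c : Fin n → ℝ) :
    Measurable fun Y : Matrix (Fin n) (Fin p) ℝ => c ⬝ᵥ (grass Y *ᵥ c) := by
  simp only [dotProduct, Matrix.mulVec]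
  refine Finset.measurable_sum _ fun i _ => Measurable.const_mul
    (Finset.measurable_sum _ fun j _ => Measurable.mul_const ?_ _) _
  exact measurable_matrix_iff.1 measurable_grass i j

theorem measurable_spikeStat (c : Fin n → ℝ) : Measurable (spikeStat p c) := by
  simp only [funext (spikeStat_eq c)]
  exact measurable_dotProduct_grass c

/-- A symmetric idempotent matrix is orthogonally similar to a coordinate projection. -/
theorem exists_orthogonal_diagonalization {P : Matrix (Fin n) (Fin n) ℝ} (h1 : Pᵀ = P)
    (h2 : P * P = P) : ∃ (V : Matrix (Fin n) (Fin n) ℝ) (s : Finset (Fin n)), Vᵀ * V = 1 ∧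
      V * Vᵀ = 1 ∧ P = V * diagonal (fun i => if i ∈ s then 1 else 0) * Vᵀ ∧
      (s.card : ℝ) = P.trace := by
  have hP : P.IsHermitian := by
    rw [Matrix.IsHermitian, Matrix.conjTranspose_eq_transpose_of_trivial, h1]
  let V : Matrix (Fin n) (Fin n) ℝ := hP.eigenvectorUnitary.1
  have hVV : Vᵀ * V = 1 := by
    have := Unitary.coe_star_mul_self hP.eigenvectorUnitary
    rwa [Matrix.star_eq_conjTranspose, Matrix.conjTranspose_eq_transpose_of_trivial] at this
  have hVV' : V * Vᵀ = 1 := mul_eq_one_comm.1 hVV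
  have hspec : P = V * diagonal hP.eigenvalues * Vᵀ := by
    have := hP.spectral_theorem
    rwa [Unitary.conjStarAlgAut_apply, Matrix.star_eq_conjTranspose,
      Matrix.conjTranspose_eq_transpose_of_trivial] at this
  have hD : diagonal hP.eigenvalues = Vᵀ * P * V := by
    conv_rhs => rw [hspec]
    simp only [Matrix.mul_assoc, hVV, Matrix.mul_one]
    rw [← Matrix.mul_assoc, hVV, Matrix.one_mul]
  have hidem : ∀ i, hP.eigenvalues i * hP.eigenvalues i = hP.eigenvalues i := by
    have : diagonal hP.eigenvalues * diagonal hP.eigenvalues = diagonal hP.eigenvalues := by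
      rw [hD]
      calc Vᵀ * P * V * (Vᵀ * P * V) = Vᵀ * (P * (V * Vᵀ) * P) * V := by
            simp only [Matrix.mul_assoc]
        _ = Vᵀ * P * V := by rw [hVV', Matrix.mul_one, h2]
    intro i
    rw [Matrix.diagonal_mul_diagonal] at this
    exact congrFun (Matrix.diagonal_injective this) i
  have heig : hP.eigenvalues = fun i =>
      if i ∈ Finset.univ.filter (fun i => hP.eigenvalues i = 1) then (1 : ℝ) else 0 := by
    funext i
    simp only [Finset.mem_filter, Finset.mem_univ, true_and]
    split_ifs with h
    · exact h
    · have := hidem i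
      by_contra h0
      exact h (mul_left_cancel₀ h0 (by rw [this, mul_one]))
  refine ⟨V, Finset.univ.filter (fun i => hP.eigenvalues i = 1), hVV, hVV', ?_, ?_⟩
  · rw [← heig]; exact hspec
  · rw [hP.trace_eq_sum_eigenvalues]
    simp only [RCLike.ofReal_real_eq_id, id_eq]
    rw [Finset.sum_congr rfl fun i _ => congrFun heig i]
    simp

theorem measurable_matrix_mul {X : Type*} [MeasurableSpace X] {f : X → Matrix (Fin m) (Fin n) ℝ}
    {g : X → Matrix (Fin n) (Fin p) ℝ} (hf : Measurable f) (hg : Measurable g) :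
    Measurable fun x => f x * g x := by
  refine measurable_matrix_iff.2 fun i j => ?_
  simp only [Matrix.mul_apply]
  exact Finset.measurable_sum _ fun k _ =>
    (measurable_matrix_iff.1 hf i k).mul (measurable_matrix_iff.1 hg k j)

theorem measurable_matrix_inv {X : Type*} [MeasurableSpace X] {f : X → Matrix (Fin n) (Fin n) ℝ}
    (hf : Measurable f) : Measurable fun x => (f x)⁻¹ := by
  refine measurable_matrix_iff.2 fun i j => ?_
  simp only [Matrix.inv_def, Matrix.smul_apply, Ring.inverse_eq_inv', smul_eq_mul,
    Matrix.adjugate_apply]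
  refine (measurable_det (measurable_matrix_iff.1 hf)).inv.mul (measurable_det fun a b => ?_)
  simp only [Matrix.updateRow_apply]
  split_ifs
  · exact measurable_const
  · exact measurable_matrix_iff.1 hf a b

/-! ### Gaussian integrals of right-invariant functions -/

/-- The volume `√det(YᵀY)` spanned by the columns of `Y`. -/
def gramVol (Y : Matrix (Fin n) (Fin p) ℝ) : ℝ := √(Yᵀ * Y).det

theorem gramVol_nonneg (Y : Matrix (Fin n) (Fin p) ℝ) : 0 ≤ gramVol Y := Real.sqrt_nonneg _

theorem measurable_gramVol : Measurable (gramVol : Matrix (Fin n) (Fin p) ℝ → ℝ) :=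
  Real.continuous_sqrt.measurable.comp (measurable_det measurable_gram_entry)

theorem gramVol_mul (Y : Matrix (Fin n) (Fin p) ℝ) (A : Matrix (Fin p) (Fin p) ℝ) :
    gramVol (Y * A) = gramVol Y * |A.det| := by
  have : (Y * A)ᵀ * (Y * A) = Aᵀ * (Yᵀ * Y) * A := by
    simp only [Matrix.transpose_mul, Matrix.mul_assoc]
  rw [gramVol, gramVol, this, Matrix.det_mul, Matrix.det_mul, Matrix.det_transpose,
    mul_comm A.det, mul_assoc, Real.sqrt_mul' _ (mul_self_nonneg _), Real.sqrt_mul_self_eq_abs]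

/-- A square factor of the Gram matrix. -/
theorem exists_gram_factor {Y : Matrix (Fin n) (Fin p) ℝ} (h : (Yᵀ * Y).det ≠ 0) :
    ∃ T : Matrix (Fin p) (Fin p) ℝ, Tᵀ * T = Yᵀ * Y ∧ T.det ≠ 0 ∧ |T.det| = gramVol Y := by
  have hpos : (Yᵀ * Y).PosSemidef := by simpa using Matrix.posSemidef_conjTranspose_mul_self Y
  obtain ⟨T, hT⟩ := CStarAlgebra.nonneg_iff_eq_star_mul_self.1 hpos.nonneg
  rw [Matrix.star_eq_conjTranspose, Matrix.conjTranspose_eq_transpose_of_trivial] at hT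
  refine ⟨T, hT.symm, fun h0 => h ?_, ?_⟩
  · rw [hT, Matrix.det_mul, h0, mul_zero]
  · rw [gramVol, hT, Matrix.det_mul, Matrix.det_transpose, Real.sqrt_mul_self_eq_abs]

/-- The weight sees only the Gram matrix. A rectangular `Y` can thus be traded for an invertible
square `T`, which a change of variables in `A` can absorb. -/
theorem gaussWeight_mul_congr {Y : Matrix (Fin n) (Fin p) ℝ} {T : Matrix (Fin m) (Fin p) ℝ}
    (h : Tᵀ * T = Yᵀ * Y) (A : Matrix (Fin p) (Fin k) ℝ) :
    gaussWeight (Y * A) = gaussWeight (T * A) := by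
  have h1 : (Y * A)ᵀ * (Y * A) = Aᵀ * (Yᵀ * Y) * A := by
    simp only [Matrix.transpose_mul, Matrix.mul_assoc]
  have h2 : (T * A)ᵀ * (T * A) = Aᵀ * (Tᵀ * T) * A := by
    simp only [Matrix.transpose_mul, Matrix.mul_assoc]
  rw [gaussWeight, gaussWeight, h1, h2, h]

/-- A finite multiple of this integral is the total mass `1` of the standard law. -/
theorem lintegral_gaussWeight (n p : ℕ) :
    ∫⁻ Y : Matrix (Fin n) (Fin p) ℝ, gaussWeight Y ∂matrixVolume n p ≠ 0 ∧
      ∫⁻ Y : Matrix (Fin n) (Fin p) ℝ, gaussWeight Y ∂matrixVolume n p ≠ ∞ := by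
  obtain ⟨c, hc0, hct, hc⟩ := exists_lintegral_matrixNormal_one n p
  have h := hc (fun _ => 1) measurable_const
  simp only [lintegral_one, measure_univ, one_mul] at h
  constructor <;> intro h0
  · simp [h0] at h
  · simp [h0, ENNReal.mul_top hc0] at h

/-- The integral of `|det A| ^ k` against the Gaussian weight. -/
def detMoment (p k : ℕ) : ℝ≥0∞ :=
  ∫⁻ A : Matrix (Fin p) (Fin p) ℝ, gaussWeight A * ENNReal.ofReal (|A.det| ^ k) ∂matrixVolume p p

theorem measurable_abs_det : Measurable fun A : Matrix (Fin p) (Fin p) ℝ => |A.det| :=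
  (measurable_det measurable_entry).abs

theorem detMoment_ne_zero (p k : ℕ) : detMoment p k ≠ 0 := by
  intro h
  have hm : Measurable fun A : Matrix (Fin p) (Fin p) ℝ =>
      gaussWeight A * ENNReal.ofReal (|A.det| ^ k) :=
    measurable_gaussWeight.mul (ENNReal.measurable_ofReal.comp (measurable_abs_det.pow_const k))
  rw [detMoment, lintegral_eq_zero_iff hm] at h
  have hne : (ae (matrixVolume p p)).NeBot := by
    rw [ae_neBot]
    intro h0
    apply (lintegral_gaussWeight p p).1
    rw [h0, lintegral_zero_measure]
  obtain ⟨A, hA, hdet⟩ := (h.and (ae_det_gram_ne_zero (le_refl p))).exists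
  have hd : A.det ≠ 0 := fun h0 => hdet (by rw [Matrix.det_mul, h0, mul_zero])
  simp only [Pi.zero_apply, gaussWeight] at hA
  rw [← ENNReal.ofReal_mul (Real.exp_pos _).le, ENNReal.ofReal_eq_zero] at hA
  have : 0 < |A.det| ^ k := pow_pos (abs_pos.2 hd) k
  have := mul_pos (Real.exp_pos (-(Aᵀ * A).trace / 2)) this
  linarith

/-- The determinant grows polynomially in the Frobenius norm, and half of the Gaussian exponent
absorbs that growth. Finiteness is needed to cancel this constant later. -/
theorem detMoment_ne_top (p k : ℕ) : detMoment p k ≠ ∞ := by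
  let C : ℝ := (p.factorial : ℝ) ^ k * ((p * k).factorial * Real.exp 1)
  have hbound : ∀ A : Matrix (Fin p) (Fin p) ℝ, gaussWeight A * ENNReal.ofReal (|A.det| ^ k) ≤
      ENNReal.ofReal C * gaussWeight ((√2)⁻¹ • A) := by
    intro A
    set t := (Aᵀ * A).trace with ht
    have htsum : t = ∑ j, ∑ i, A i j * A i j := by
      simp [ht, Matrix.trace, Matrix.mul_apply]
    have ht0 : 0 ≤ t := by
      rw [htsum]
      exact Finset.sum_nonneg fun j _ => Finset.sum_nonneg fun i _ => mul_self_nonneg _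
    have hentry : ∀ i j, |A i j| ≤ √t := by
      intro i j
      apply Real.le_sqrt_of_sq_le
      rw [sq_abs, pow_two, htsum]
      exact (Finset.single_le_sum (f := fun i => A i j * A i j) (fun i _ => mul_self_nonneg _)
        (Finset.mem_univ i)).trans (Finset.single_le_sum (f := fun j => ∑ i, A i j * A i j)
        (fun j _ => Finset.sum_nonneg fun i _ => mul_self_nonneg _) (Finset.mem_univ j))
    have hdet : |A.det| ≤ p.factorial * √t ^ p := by
      have := Matrix.det_le (abv := AbsoluteValue.abs) (A := A) (x := √t) hentry
      simpa [nsmul_eq_mul] using this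
    set u := √t with hu
    have hu0 : 0 ≤ u := Real.sqrt_nonneg t
    have hut : u ^ 2 = t := Real.sq_sqrt ht0
    have hpow : u ^ (p * k) ≤ (p * k).factorial * Real.exp u := by
      have := Real.pow_div_factorial_le_exp u hu0 (p * k)
      rwa [div_le_iff₀ (by positivity), mul_comm (Real.exp u)] at this
    have hscale : (((√2)⁻¹ • A)ᵀ * ((√2)⁻¹ • A)).trace = t / 2 := by
      rw [Matrix.transpose_smul, Matrix.smul_mul, Matrix.mul_smul, smul_smul, Matrix.trace_smul,
        ← mul_inv, Real.mul_self_sqrt (by norm_num), smul_eq_mul, ← ht]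
      ring
    rw [gaussWeight, gaussWeight, ← ENNReal.ofReal_mul (Real.exp_pos _).le,
      ← ENNReal.ofReal_mul (by positivity), hscale, ← ht]
    apply ENNReal.ofReal_le_ofReal
    have h1 : |A.det| ^ k ≤ (p.factorial : ℝ) ^ k * ((p * k).factorial * Real.exp u) := by
      calc |A.det| ^ k ≤ (p.factorial * u ^ p) ^ k := pow_le_pow_left₀ (abs_nonneg _) hdet k
        _ = (p.factorial : ℝ) ^ k * u ^ (p * k) := by rw [mul_pow, ← pow_mul]
        _ ≤ _ := by gcongr
    calc Real.exp (-t / 2) * |A.det| ^ k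
        ≤ Real.exp (-t / 2) * ((p.factorial : ℝ) ^ k * ((p * k).factorial * Real.exp u)) := by
          gcongr
      _ = (p.factorial : ℝ) ^ k * ((p * k).factorial * Real.exp (-t / 2 + u)) := by
          rw [Real.exp_add]; ring
      _ ≤ (p.factorial : ℝ) ^ k * ((p * k).factorial * Real.exp (1 + -(t / 2) / 2)) := by
          gcongr _ * (_ * Real.exp ?_)
          -- The claim `-u²/2 + u ≤ 1 - u²/4` is `(u - 2)² ≥ 0`; it is the source of the factor `exp
          -- 1` in `C`.
          nlinarith [sq_nonneg (u - 2)]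
      _ = C * Real.exp (-(t / 2) / 2) := by rw [Real.exp_add]; ring
  have hd : (((√2)⁻¹ : ℝ) • (1 : Matrix (Fin p) (Fin p) ℝ)).det ≠ 0 := by
    rw [Matrix.det_smul, Matrix.det_one, mul_one]
    positivity
  have hint := lintegral_matrixVolume_mul_mul hd
    (by rw [Matrix.det_one]; exact one_ne_zero : (1 : Matrix (Fin p) (Fin p) ℝ).det ≠ 0)
    (measurable_gaussWeight (n := p) (p := p))
  simp only [Matrix.smul_mul, Matrix.one_mul, Matrix.mul_one] at hint
  have hfin : ∫⁻ A : Matrix (Fin p) (Fin p) ℝ, gaussWeight ((√2)⁻¹ • A) ∂matrixVolume p p ≠ ∞ := by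
    intro h
    rw [h, ENNReal.mul_top] at hint
    · exact (lintegral_gaussWeight p p).2 hint
    · rw [Ne, ENNReal.ofReal_eq_zero, not_le]
      simp only [Matrix.det_one, abs_one, one_pow, mul_one]
      exact pow_pos (abs_pos.2 hd) p
  refine ne_top_of_le_ne_top ?_ (lintegral_mono hbound)
  rw [lintegral_const_mul' _ _ ENNReal.ofReal_ne_top]
  exact ENNReal.mul_ne_top ENNReal.ofReal_ne_top hfin

/-- Substituting `T⁻¹A` for `A` costs `|det T|^(-p)` from the Jacobian and `|det T|^(-(n-p))` from
the integrand. -/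
theorem lintegral_gaussWeight_mul_left (h : p ≤ n) {T : Matrix (Fin p) (Fin p) ℝ}
    (hT : T.det ≠ 0) :
    ∫⁻ A, gaussWeight (T * A) * ENNReal.ofReal (|A.det| ^ (n - p)) ∂matrixVolume p p =
      ENNReal.ofReal (|T.det|⁻¹ ^ n) * detMoment p (n - p) := by
  have hu : IsUnit T.det := isUnit_iff_ne_zero.2 hT
  have hm : Measurable fun A : Matrix (Fin p) (Fin p) ℝ =>
      gaussWeight (T * A) * ENNReal.ofReal (|A.det| ^ (n - p)) :=
    (measurable_gaussWeight.comp (measurable_matrix_mul measurable_const measurable_id)).mul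
      (ENNReal.measurable_ofReal.comp (measurable_abs_det.pow_const _))
  have hTi : T⁻¹.det ≠ 0 := by
    rw [Matrix.det_nonsing_inv, Ring.inverse_eq_inv']; exact inv_ne_zero hT
  rw [lintegral_matrixVolume_mul_mul hTi
    (by rw [Matrix.det_one]; exact one_ne_zero : (1 : Matrix (Fin p) (Fin p) ℝ).det ≠ 0) hm]
  simp only [Matrix.mul_nonsing_inv_cancel_left _ _ hu, Matrix.det_mul,
    Matrix.det_nonsing_inv, Ring.inverse_eq_inv', abs_mul, mul_pow, abs_inv, Matrix.det_one,
    abs_one, one_pow, mul_one]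
  have : ∀ A : Matrix (Fin p) (Fin p) ℝ,
      gaussWeight A * ENNReal.ofReal (|T.det|⁻¹ ^ (n - p) * |A.det| ^ (n - p)) =
        ENNReal.ofReal (|T.det|⁻¹ ^ (n - p)) *
          (gaussWeight A * ENNReal.ofReal (|A.det| ^ (n - p))) := by
    intro A
    rw [ENNReal.ofReal_mul (by positivity)]; ring
  simp only [inv_pow] at this ⊢
  simp only [this]
  rw [lintegral_const_mul' _ _ ENNReal.ofReal_ne_top, ← mul_assoc,
    ← ENNReal.ofReal_mul (by positivity), ← mul_inv, ← pow_add, Nat.add_sub_cancel' h]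
  rfl

/-- The integral of `exp (-|A⁻¹|² / 2)` against `|det A| ^ (-k) dA`. -/
def invDetMoment (p k : ℕ) : ℝ≥0∞ :=
  ∫⁻ A : Matrix (Fin p) (Fin p) ℝ, gaussWeight A⁻¹ * ENNReal.ofReal (|A.det|⁻¹ ^ k)
    ∂matrixVolume p p

/-- Substituting `AT` for `A` gives `|det T|^p` from the Jacobian against `|det T|^(-(p+n))` from
the integrand. -/
theorem lintegral_gaussWeight_mul_inv (n : ℕ) {T : Matrix (Fin p) (Fin p) ℝ} (hT : T.det ≠ 0) :
    ∫⁻ A, gaussWeight (T * A⁻¹) * ENNReal.ofReal (|A.det|⁻¹ ^ (p + n)) ∂matrixVolume p p =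
      ENNReal.ofReal (|T.det|⁻¹ ^ n) * invDetMoment p (p + n) := by
  have hu : IsUnit T.det := isUnit_iff_ne_zero.2 hT
  have hm : Measurable fun A : Matrix (Fin p) (Fin p) ℝ =>
      gaussWeight (T * A⁻¹) * ENNReal.ofReal (|A.det|⁻¹ ^ (p + n)) :=
    (measurable_gaussWeight.comp (measurable_matrix_mul measurable_const
      (measurable_matrix_inv measurable_id))).mul
      (ENNReal.measurable_ofReal.comp (measurable_abs_det.inv.pow_const _))
  rw [lintegral_matrixVolume_mul_mul
    (by rw [Matrix.det_one]; exact one_ne_zero : (1 : Matrix (Fin p) (Fin p) ℝ).det ≠ 0) hT hm]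
  simp only [Matrix.mul_inv_rev, Matrix.mul_nonsing_inv_cancel_left _ _ hu,
    Matrix.det_mul, abs_mul, Matrix.det_one, abs_one, one_pow, one_mul, _root_.mul_inv_rev, mul_pow]
  have : ∀ A : Matrix (Fin p) (Fin p) ℝ,
      gaussWeight A⁻¹ * ENNReal.ofReal (|T.det|⁻¹ ^ (p + n) * |A.det|⁻¹ ^ (p + n)) =
        ENNReal.ofReal (|T.det|⁻¹ ^ (p + n)) *
          (gaussWeight A⁻¹ * ENNReal.ofReal (|A.det|⁻¹ ^ (p + n))) := by
    intro A
    rw [ENNReal.ofReal_mul (by positivity)]; ring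
  simp only [this]
  rw [lintegral_const_mul' _ _ ENNReal.ofReal_ne_top, ← mul_assoc,
    ← ENNReal.ofReal_mul (by positivity), pow_add, ← mul_assoc, ← mul_pow,
    mul_inv_cancel₀ (abs_ne_zero.2 hT), one_pow, one_mul]
  rfl

theorem det_gram_mul_left_ne_zero {N : Matrix (Fin n) (Fin n) ℝ} (hN : N.det ≠ 0)
    {Y : Matrix (Fin n) (Fin p) ℝ} (hY : (Yᵀ * Y).det ≠ 0) : ((N * Y)ᵀ * (N * Y)).det ≠ 0 := by
  rw [det_gram_ne_zero_iff] at hY ⊢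
  intro v hv
  apply hY
  rw [← Matrix.mulVec_mulVec] at hv
  by_contra h0
  exact hN (Matrix.exists_mulVec_eq_zero_iff.1 ⟨_, h0, hv⟩)

/-- Averaging over the group of right translations, in the two possible orders. -/
theorem lintegral_invariant_aux (h : p ≤ n) {F : Matrix (Fin n) (Fin p) ℝ → ℝ≥0∞}
    (hFm : Measurable F) (hF : ∀ A : Matrix (Fin p) (Fin p) ℝ, A.det ≠ 0 → ∀ Y, F (Y * A) = F Y)
    {N : Matrix (Fin n) (Fin n) ℝ} (hN : N.det ≠ 0) :
    detMoment p (n - p) * ∫⁻ Y, F Y * ENNReal.ofReal ((gramVol Y / gramVol (N * Y)) ^ n) *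
        gaussWeight Y ∂matrixVolume n p =
      invDetMoment p (p + n) * ∫⁻ Y, F Y * gaussWeight (N * Y) ∂matrixVolume n p := by
  have hY := ae_det_gram_ne_zero h
  have hA : ∀ᵐ A ∂matrixVolume p p, A.det ≠ 0 := by
    filter_upwards [ae_det_gram_ne_zero (le_refl p)] with A hA h0
    exact hA (by rw [Matrix.det_mul, h0, mul_zero])
  have hg : Measurable fun Y : Matrix (Fin n) (Fin p) ℝ => gaussWeight (N * Y) :=
    measurable_gaussWeight.comp (measurable_matrix_mul measurable_const measurable_id)
  -- Integrating `Φ` over `A` produces `vol(NY)^(-n)` and leaves the weight of `Y`. Integrating `Θ`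
  -- over `A` produces `vol(Y)^(-n)`, which cancels the prefactor and leaves the weight of `NY`.
  let Φ : Matrix (Fin n) (Fin p) ℝ → Matrix (Fin p) (Fin p) ℝ → ℝ≥0∞ := fun Y A =>
    F Y * ENNReal.ofReal (gramVol Y ^ n) * gaussWeight Y *
      (gaussWeight (N * Y * A) * ENNReal.ofReal (|A.det| ^ (n - p)))
  let Θ : Matrix (Fin n) (Fin p) ℝ → Matrix (Fin p) (Fin p) ℝ → ℝ≥0∞ := fun Y A =>
    F Y * ENNReal.ofReal (gramVol Y ^ n) * gaussWeight (N * Y) *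
      (gaussWeight (Y * A⁻¹) * ENNReal.ofReal (|A.det|⁻¹ ^ (p + n)))
  have hΦ : Measurable (Function.uncurry Φ) := by
    refine Measurable.mul (((hFm.mul (ENNReal.measurable_ofReal.comp
      (measurable_gramVol.pow_const n))).mul measurable_gaussWeight).comp measurable_fst)
      (Measurable.mul (measurable_gaussWeight.comp (measurable_matrix_mul
        (measurable_matrix_mul measurable_const measurable_fst) measurable_snd))
      ((ENNReal.measurable_ofReal.comp (measurable_abs_det.pow_const _)).comp measurable_snd))
  have hΘ : Measurable (Function.uncurry Θ) := by
    refine Measurable.mul (((hFm.mul (ENNReal.measurable_ofReal.comp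
      (measurable_gramVol.pow_const n))).mul hg).comp measurable_fst)
      (Measurable.mul (measurable_gaussWeight.comp (measurable_matrix_mul measurable_fst
        (measurable_matrix_inv measurable_snd)))
      ((ENNReal.measurable_ofReal.comp (measurable_abs_det.inv.pow_const _)).comp measurable_snd))
  have h1 : ∫⁻ Y, ∫⁻ A, Φ Y A ∂matrixVolume p p ∂matrixVolume n p =
      detMoment p (n - p) * ∫⁻ Y, F Y * ENNReal.ofReal ((gramVol Y / gramVol (N * Y)) ^ n) *
        gaussWeight Y ∂matrixVolume n p := by
    rw [← lintegral_const_mul' _ _ (detMoment_ne_top p (n - p))]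
    refine lintegral_congr_ae ?_
    filter_upwards [hY] with Y hY
    obtain ⟨T, hT, hT0, hTq⟩ := exists_gram_factor (det_gram_mul_left_ne_zero hN hY)
    have hmm : Measurable fun A : Matrix (Fin p) (Fin p) ℝ =>
        gaussWeight (T * A) * ENNReal.ofReal (|A.det| ^ (n - p)) :=
      (measurable_gaussWeight.comp (measurable_matrix_mul measurable_const measurable_id)).mul
        (ENNReal.measurable_ofReal.comp (measurable_abs_det.pow_const _))
    simp only [Φ, gaussWeight_mul_congr hT]
    rw [lintegral_const_mul _ hmm, lintegral_gaussWeight_mul_left h hT0, hTq, div_eq_mul_inv,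
      mul_pow, ENNReal.ofReal_mul (pow_nonneg (gramVol_nonneg _) n)]
    ring
  have h2 : ∫⁻ Y, ∫⁻ A, Θ Y A ∂matrixVolume p p ∂matrixVolume n p =
      invDetMoment p (p + n) * ∫⁻ Y, F Y * gaussWeight (N * Y) ∂matrixVolume n p := by
    rw [← lintegral_const_mul _ (f := fun Y => F Y * gaussWeight (N * Y)) (hFm.mul hg)]
    refine lintegral_congr_ae ?_
    filter_upwards [hY] with Y hY
    obtain ⟨T, hT, hT0, hTq⟩ := exists_gram_factor hY
    have hmm : Measurable fun A : Matrix (Fin p) (Fin p) ℝ =>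
        gaussWeight (T * A⁻¹) * ENNReal.ofReal (|A.det|⁻¹ ^ (p + n)) :=
      (measurable_gaussWeight.comp (measurable_matrix_mul measurable_const
        (measurable_matrix_inv measurable_id))).mul
        (ENNReal.measurable_ofReal.comp (measurable_abs_det.inv.pow_const _))
    have hcancel : ENNReal.ofReal (gramVol Y ^ n) * ENNReal.ofReal ((gramVol Y)⁻¹ ^ n) = 1 := by
      rw [← ENNReal.ofReal_mul (pow_nonneg (gramVol_nonneg _) n), ← mul_pow, mul_inv_cancel₀,
        one_pow, ENNReal.ofReal_one]
      rw [← hTq]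
      exact abs_ne_zero.2 hT0
    simp only [Θ, gaussWeight_mul_congr hT]
    rw [lintegral_const_mul _ hmm, lintegral_gaussWeight_mul_inv n hT0, hTq]
    calc _ = F Y * gaussWeight (N * Y) * (ENNReal.ofReal (gramVol Y ^ n) *
          ENNReal.ofReal ((gramVol Y)⁻¹ ^ n)) * invDetMoment p (p + n) := by ring
      _ = _ := by rw [hcancel]; ring
  rw [← h1, ← h2, lintegral_lintegral_swap hΦ.aemeasurable, lintegral_lintegral_swap hΘ.aemeasurable]
  refine lintegral_congr_ae ?_
  filter_upwards [hA] with A hA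
  have hu : IsUnit A.det := isUnit_iff_ne_zero.2 hA
  have hAi : A⁻¹.det ≠ 0 := by
    rw [Matrix.det_nonsing_inv, Ring.inverse_eq_inv']; exact inv_ne_zero hA
  have hΦA : Measurable fun Y => Φ Y A := hΦ.comp (measurable_id.prodMk measurable_const)
  -- For fixed `A`, substituting `YA⁻¹` for `Y` carries `Φ` to `Θ`. The Jacobian and `volⁿ` each
  -- give `|det A|^(-n)`, which with `|det A|^(n-p)` makes `|det A|^(-(p+n))`.
  rw [lintegral_matrixVolume_mul_mul
    (by rw [Matrix.det_one]; exact one_ne_zero : (1 : Matrix (Fin n) (Fin n) ℝ).det ≠ 0) hAi hΦA,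
    ← lintegral_const_mul' _ _ ENNReal.ofReal_ne_top]
  refine lintegral_congr fun Y => ?_
  have hpow : |A.det|⁻¹ ^ n * (|A.det|⁻¹ ^ n * |A.det| ^ (n - p)) = |A.det|⁻¹ ^ (p + n) := by
    have h0 := abs_ne_zero.2 hA
    have : |A.det| ^ n = |A.det| ^ p * |A.det| ^ (n - p) := by
      rw [← pow_add, Nat.add_sub_cancel' h]
    rw [pow_add]
    simp only [inv_pow]
    field_simp
    rw [this, mul_comm]
  simp only [Φ, Θ, Matrix.one_mul, hF _ hAi, gramVol_mul, Matrix.det_one, abs_one, one_pow, one_mul,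
    ← Matrix.mul_assoc N, Matrix.nonsing_inv_mul_cancel_right _ _ hu, Matrix.det_nonsing_inv,
    Ring.inverse_eq_inv', abs_inv, mul_pow, ← hpow]
  rw [ENNReal.ofReal_mul (pow_nonneg (gramVol_nonneg _) n), ENNReal.ofReal_mul (by positivity),
    ENNReal.ofReal_mul (by positivity)]
  ring

/-- With `F = 1` and `N = 1` the two integrals in `lintegral_invariant_aux` agree and are finite and
nonzero, so the constants agree without being computed. -/
theorem invDetMoment_eq (h : p ≤ n) : invDetMoment p (p + n) = detMoment p (n - p) := by
  have := lintegral_invariant_aux (N := (1 : Matrix (Fin n) (Fin n) ℝ)) h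
    (measurable_const (a := (1 : ℝ≥0∞))) (fun _ _ _ => rfl)
    (by rw [Matrix.det_one]; exact one_ne_zero)
  have hae : ∫⁻ Y : Matrix (Fin n) (Fin p) ℝ, 1 * ENNReal.ofReal
      ((gramVol Y / gramVol ((1 : Matrix (Fin n) (Fin n) ℝ) * Y)) ^ n) *
        gaussWeight Y ∂matrixVolume n p = ∫⁻ Y, gaussWeight Y ∂matrixVolume n p := by
    refine lintegral_congr_ae ?_
    filter_upwards [ae_det_gram_ne_zero h] with Y hY
    obtain ⟨T, -, hT0, hTq⟩ := exists_gram_factor hY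
    rw [Matrix.one_mul, div_self (by rw [← hTq]; exact abs_ne_zero.2 hT0)]
    simp
  rw [hae] at this
  simp only [Matrix.one_mul, one_mul] at this
  exact ((ENNReal.mul_left_inj (lintegral_gaussWeight n p).1 (lintegral_gaussWeight n p).2).1
    this).symm

/-- For full-rank `Y` an invariant function sees only the column space. Up to a constant, the volume
ratio is the density of the column space of `N⁻¹Z` relative to that of `Z`, for `Z` standard
Gaussian. -/
theorem lintegral_invariant (h : p ≤ n) {F : Matrix (Fin n) (Fin p) ℝ → ℝ≥0∞}
    (hFm : Measurable F) (hF : ∀ A : Matrix (Fin p) (Fin p) ℝ, A.det ≠ 0 → ∀ Y, F (Y * A) = F Y)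
    {N : Matrix (Fin n) (Fin n) ℝ} (hN : N.det ≠ 0) :
    ∫⁻ Y, F Y * gaussWeight (N * Y) ∂matrixVolume n p =
      ∫⁻ Y, F Y * ENNReal.ofReal ((gramVol Y / gramVol (N * Y)) ^ n) *
        gaussWeight Y ∂matrixVolume n p := by
  have := lintegral_invariant_aux h hFm hF hN
  rw [invDetMoment_eq h] at this
  exact ((ENNReal.mul_right_inj (detMoment_ne_zero p _) (detMoment_ne_top p _)).1 this).symm

/-! ### Polar coordinates and the beta law -/

/-- Radial integration in `ℝ^ι`. -/
theorem exists_lintegral_dotProduct_self (ι : Type*) [Fintype ι] [Nonempty ι] :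
    ∃ C : ℝ≥0∞, ∀ f : ℝ → ℝ≥0∞, Measurable f → ∫⁻ x : ι → ℝ, f (x ⬝ᵥ x) =
      C * ∫⁻ r in Set.Ioi (0 : ℝ), ENNReal.ofReal (r ^ (Fintype.card ι - 1)) * f (r ^ 2) := by
  let E := EuclideanSpace ℝ ι
  let μ : Measure E := volume
  refine ⟨μ.toSphere Set.univ, fun f hf => ?_⟩
  have hf' : Measurable fun r : ℝ => f (r ^ 2) := hf.comp (by fun_prop)
  have h1 : ∫⁻ x : ι → ℝ, f (x ⬝ᵥ x) = ∫⁻ x : E, f (‖x‖ ^ 2) ∂μ := by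
    rw [← (PiLp.volume_preserving_toLp ι).lintegral_comp
      (f := fun x : E => f (‖x‖ ^ 2)) (hf'.comp measurable_norm)]
    refine lintegral_congr fun x => ?_
    have h : ‖(WithLp.toLp 2 x : EuclideanSpace ℝ ι)‖ ^ 2 = x ⬝ᵥ x := by
      rw [EuclideanSpace.real_norm_sq_eq]
      simp only [dotProduct, ← pow_two]
    exact congrArg f h.symm
  have hdim : Module.finrank ℝ E = Fintype.card ι := finrank_euclideanSpace
  rw [h1]
  -- The origin, a null set, is removed so that the homeomorphism with sphere times half-line
  -- applies.
  calc ∫⁻ x, f (‖x‖ ^ 2) ∂μ = ∫⁻ x : ({(0)}ᶜ : Set E), f (‖x.1‖ ^ 2) ∂(μ.comap (↑)) := by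
        rw [lintegral_subtype_comap (measurableSet_singleton _).compl fun x => f (‖x‖ ^ 2),
          restrict_compl_singleton]
    _ = ∫⁻ x : Metric.sphere (0 : E) 1 × Set.Ioi (0 : ℝ), f (x.2.1 ^ 2)
          ∂μ.toSphere.prod (.volumeIoiPow (Module.finrank ℝ E - 1)) := by
        rw [← μ.measurePreserving_homeomorphUnitSphereProd.lintegral_comp_emb
          (Homeomorph.measurableEmbedding _)]
        simp
    _ = μ.toSphere Set.univ *
          ∫⁻ r : Set.Ioi (0 : ℝ), f (r.1 ^ 2) ∂.volumeIoiPow (Module.finrank ℝ E - 1) := by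
        have hm : Measurable fun r : Set.Ioi (0 : ℝ) => f (r.1 ^ 2) :=
          hf'.comp measurable_subtype_coe
        have := lintegral_prod_mul (μ := μ.toSphere)
          (ν := Measure.volumeIoiPow (Module.finrank ℝ E - 1)) (f := fun _ => 1)
          (g := fun r : Set.Ioi (0 : ℝ) => f (r.1 ^ 2)) aemeasurable_const hm.aemeasurable
        simpa using this
    _ = _ := by
        rw [Measure.volumeIoiPow, lintegral_withDensity_eq_lintegral_mul _ (by fun_prop)
          (g := fun r : Set.Ioi (0 : ℝ) => f (r.1 ^ 2)) (hf'.comp measurable_subtype_coe), hdim]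
        congr 1
        exact lintegral_subtype_comap measurableSet_Ioi
          fun r => ENNReal.ofReal (r ^ (Fintype.card ι - 1)) * f (r ^ 2)

theorem image_cos_sq : (fun θ => Real.cos θ ^ 2) '' Set.Ioo 0 (Real.pi / 2) = Set.Ioo 0 1 := by
  ext x
  constructor
  · rintro ⟨θ, ⟨h0, h1⟩, rfl⟩
    have hc := Real.cos_pos_of_mem_Ioo ⟨by linarith [Real.pi_pos], h1⟩
    have hs := Real.sin_pos_of_pos_of_lt_pi h0 (by linarith [Real.pi_pos])
    refine ⟨by positivity, ?_⟩
    have := Real.sin_sq_add_cos_sq θ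
    have : 0 < Real.sin θ ^ 2 := by positivity
    show Real.cos θ ^ 2 < 1
    linarith
  · rintro ⟨h0, h1⟩
    refine ⟨Real.arccos √x, ⟨?_, ?_⟩, ?_⟩
    · rw [Real.arccos_pos, Real.sqrt_lt' one_pos]; simpa using h1
    · exact Real.arccos_lt_pi_div_two.2 (Real.sqrt_pos.2 h0)
    · have h := Real.sqrt_nonneg x
      show Real.cos (Real.arccos √x) ^ 2 = x
      rw [Real.cos_arccos (by linarith) (Real.sqrt_le_one.2 h1.le), Real.sq_sqrt h0.le]

/-- The beta law in the angular coordinate `x = cos² θ`. -/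
theorem lintegral_betaMeasure {a b : ℕ} (ha : 0 < a) (hb : 0 < b) {F : ℝ → ℝ≥0∞}
    (hF : Measurable F) :
    ∫⁻ x, F x ∂betaMeasure ((a : ℝ) / 2) ((b : ℝ) / 2) =
      ENNReal.ofReal (2 / beta ((a : ℝ) / 2) ((b : ℝ) / 2)) *
        ∫⁻ θ in Set.Ioo 0 (Real.pi / 2), ENNReal.ofReal (Real.cos θ ^ (a - 1) * Real.sin θ ^ (b - 1)) *
          F (Real.cos θ ^ 2) := by
  have ha' : (0 : ℝ) < (a : ℝ) / 2 := by positivity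
  have hb' : (0 : ℝ) < (b : ℝ) / 2 := by positivity
  have hB := beta_pos ha' hb'
  have hpdf : Measurable (betaPDF ((a : ℝ) / 2) ((b : ℝ) / 2)) :=
    (measurable_betaPDFReal _ _).ennreal_ofReal
  rw [betaMeasure, lintegral_withDensity_eq_lintegral_mul _ hpdf hF]
  have h1 : ∫⁻ x, (betaPDF ((a : ℝ) / 2) ((b : ℝ) / 2) * F) x =
      ∫⁻ x in Set.Ioo 0 1, betaPDF ((a : ℝ) / 2) ((b : ℝ) / 2) x * F x := by
    rw [← lintegral_indicator measurableSet_Ioo]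
    refine lintegral_congr fun x => ?_
    by_cases hx : x ∈ Set.Ioo (0 : ℝ) 1
    · rw [Set.indicator_of_mem hx, Pi.mul_apply]
    · rw [Set.indicator_of_notMem hx, Pi.mul_apply, betaPDF_eq,
        if_neg (show ¬(0 < x ∧ x < 1) from hx), ENNReal.ofReal_zero,
        zero_mul]
  rw [h1, ← image_cos_sq, lintegral_image_eq_lintegral_abs_deriv_mul measurableSet_Ioo
    (f' := fun θ => 2 * Real.cos θ * -Real.sin θ), ← lintegral_const_mul' _ _ ENNReal.ofReal_ne_top]
  · refine setLIntegral_congr_fun measurableSet_Ioo fun θ hθ => ?_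
    have hc := Real.cos_pos_of_mem_Ioo ⟨by linarith [Real.pi_pos, hθ.1], hθ.2⟩
    have hs := Real.sin_pos_of_pos_of_lt_pi hθ.1 (by linarith [Real.pi_pos, hθ.2])
    have hmem : Real.cos θ ^ 2 ∈ Set.Ioo (0 : ℝ) 1 := by
      rw [← image_cos_sq]; exact ⟨θ, hθ, rfl⟩
    -- One factor `cos θ` and one factor `sin θ` of the Jacobian turn the half-integer powers of the
    -- beta density into natural ones; `0 < d` keeps `d - 1` from truncating.
    have hpow : ∀ {z : ℝ} {d : ℕ}, 0 < z → 0 < d → z * (z ^ 2) ^ ((d : ℝ) / 2 - 1) = z ^ (d - 1) := by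
      intro z d hz hd
      rw [← Real.rpow_natCast z 2, ← Real.rpow_mul hz.le, ← Real.rpow_natCast z (d - 1),
        Nat.cast_sub hd]
      nth_rw 1 [← Real.rpow_one z]
      rw [← Real.rpow_add hz]
      congr 1
      push_cast
      ring
    show ENNReal.ofReal |2 * Real.cos θ * -Real.sin θ| *
      (betaPDF ((a : ℝ) / 2) ((b : ℝ) / 2) (Real.cos θ ^ 2) * F (Real.cos θ ^ 2)) = _
    rw [betaPDF_of_pos_lt_one hmem.1 hmem.2, ← mul_assoc, ← mul_assoc,
      ← ENNReal.ofReal_mul (abs_nonneg _), ← ENNReal.ofReal_mul (by positivity)]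
    congr 2
    have hsin : 1 - Real.cos θ ^ 2 = Real.sin θ ^ 2 := by rw [Real.sin_sq]
    rw [hsin, mul_neg, abs_neg, abs_of_pos (by positivity), ← hpow hc ha, ← hpow hs hb]
    ring
  · intro θ _
    have := ((Real.hasDerivAt_cos θ).fun_pow 2).hasDerivWithinAt (s := Set.Ioo 0 (Real.pi / 2))
    simpa using this
  · intro x hx y hy hxy
    have hcx := Real.cos_pos_of_mem_Ioo ⟨by linarith [Real.pi_pos, hx.1], hx.2⟩
    have hcy := Real.cos_pos_of_mem_Ioo ⟨by linarith [Real.pi_pos, hy.1], hy.2⟩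
    have : Real.cos x = Real.cos y := by
      have := (sq_eq_sq₀ hcx.le hcy.le).1 hxy
      exact this
    exact Real.injOn_cos ⟨hx.1.le, by linarith [Real.pi_pos, hx.2]⟩
      ⟨hy.1.le, by linarith [Real.pi_pos, hy.2]⟩ this

/-- The planar integral behind the beta law of `r² / (r² + s²)`. -/
theorem exists_lintegral_quadrant {a b : ℕ} (ha : 0 < a) (hb : 0 < b) :
    ∃ C : ℝ≥0∞, ∀ F : ℝ → ℝ≥0∞, Measurable F →
      ∫⁻ r in Set.Ioi (0 : ℝ), ENNReal.ofReal (r ^ (a - 1)) * ∫⁻ s in Set.Ioi (0 : ℝ),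
        ENNReal.ofReal (s ^ (b - 1)) *
          (F (r ^ 2 / (r ^ 2 + s ^ 2)) * ENNReal.ofReal (Real.exp (-(r ^ 2 + s ^ 2) / 2))) =
      C * ∫⁻ x, F x ∂betaMeasure ((a : ℝ) / 2) ((b : ℝ) / 2) := by
  let K : ℝ≥0∞ := ENNReal.ofReal (2 / beta ((a : ℝ) / 2) ((b : ℝ) / 2))
  have hK0 : K ≠ 0 := by
    have := beta_pos (α := (a : ℝ) / 2) (β := (b : ℝ) / 2) (by positivity) (by positivity)
    rw [Ne, ENNReal.ofReal_eq_zero, not_le]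
    positivity
  let R : ℝ≥0∞ := ∫⁻ ρ in Set.Ioi (0 : ℝ), ENNReal.ofReal
    (ρ * ρ ^ (a - 1) * ρ ^ (b - 1) * Real.exp (-ρ ^ 2 / 2))
  -- In polar coordinates `F` depends on the angle alone, so the radial integral `R` factors out;
  -- `K⁻¹` undoes the normalization of the angular beta integral.
  refine ⟨R * K⁻¹, fun F hF => ?_⟩
  let G : ℝ × ℝ → ℝ≥0∞ := fun z => ENNReal.ofReal (z.1 ^ (a - 1)) * (ENNReal.ofReal (z.2 ^ (b - 1)) *
    (F (z.1 ^ 2 / (z.1 ^ 2 + z.2 ^ 2)) *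
      ENNReal.ofReal (Real.exp (-(z.1 ^ 2 + z.2 ^ 2) / 2))))
  have hG : Measurable G := by fun_prop
  let Q : Set (ℝ × ℝ) := Set.Ioi 0 ×ˢ Set.Ioi 0
  have hQ : MeasurableSet Q := measurableSet_Ioi.prod measurableSet_Ioi
  have h1 : ∫⁻ r in Set.Ioi (0 : ℝ), ENNReal.ofReal (r ^ (a - 1)) * ∫⁻ s in Set.Ioi (0 : ℝ),
        ENNReal.ofReal (s ^ (b - 1)) *
          (F (r ^ 2 / (r ^ 2 + s ^ 2)) * ENNReal.ofReal (Real.exp (-(r ^ 2 + s ^ 2) / 2))) =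
      ∫⁻ z, Q.indicator G z := by
    rw [lintegral_indicator hQ, Measure.volume_eq_prod, ← Measure.prod_restrict,
      lintegral_prod _ hG.aemeasurable]
    refine lintegral_congr fun r => ?_
    exact (lintegral_const_mul' _ _ ENNReal.ofReal_ne_top).symm
  have h2 : ∫⁻ z in polarCoord.target, ENNReal.ofReal z.1 • Q.indicator G (polarCoord.symm z) =
      ∫⁻ z in Set.Ioi (0 : ℝ) ×ˢ Set.Ioo 0 (Real.pi / 2),
        ENNReal.ofReal (z.1 * z.1 ^ (a - 1) * z.1 ^ (b - 1) * Real.exp (-z.1 ^ 2 / 2)) *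
        (ENNReal.ofReal (Real.cos z.2 ^ (a - 1) * Real.sin z.2 ^ (b - 1)) *
          F (Real.cos z.2 ^ 2)) := by
    rw [← lintegral_indicator polarCoord.open_target.measurableSet,
      ← lintegral_indicator (measurableSet_Ioi.prod measurableSet_Ioo)]
    refine lintegral_congr fun z => ?_
    have hsymm : polarCoord.symm z = (z.1 * Real.cos z.2, z.1 * Real.sin z.2) := rfl
    by_cases hz : z ∈ Set.Ioi (0 : ℝ) ×ˢ Set.Ioo 0 (Real.pi / 2)
    · obtain ⟨hr, h0, hp⟩ := hz
      simp only [Set.mem_Ioi] at hr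
      have hc := Real.cos_pos_of_mem_Ioo ⟨by linarith [Real.pi_pos, h0], hp⟩
      have hs := Real.sin_pos_of_pos_of_lt_pi h0 (by linarith [Real.pi_pos])
      have ht : z ∈ polarCoord.target := by
        rw [polarCoord_target]
        exact ⟨hr, by linarith [Real.pi_pos], by linarith [Real.pi_pos]⟩
      have hq : polarCoord.symm z ∈ Q := by
        rw [hsymm]; exact ⟨mul_pos hr hc, mul_pos hr hs⟩
      rw [Set.indicator_of_mem ht,
          Set.indicator_of_mem (s := Set.Ioi (0 : ℝ) ×ˢ Set.Ioo 0 (Real.pi / 2)) ⟨hr, h0, hp⟩,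
        Set.indicator_of_mem hq, hsymm, smul_eq_mul]
      have hsum : (z.1 * Real.cos z.2) ^ 2 + (z.1 * Real.sin z.2) ^ 2 = z.1 ^ 2 := by
        have := Real.sin_sq_add_cos_sq z.2
        linear_combination z.1 ^ 2 * this
      have hquot : (z.1 * Real.cos z.2) ^ 2 / z.1 ^ 2 = Real.cos z.2 ^ 2 := by field_simp
      simp only [G, hsum, hquot]
      simp only [mul_pow]
      rw [ENNReal.ofReal_mul (by positivity), ENNReal.ofReal_mul (by positivity),
        ENNReal.ofReal_mul (by positivity), ENNReal.ofReal_mul (by positivity),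
        ENNReal.ofReal_mul (by positivity), ENNReal.ofReal_mul (by positivity)]
      ring
    · rw [Set.indicator_of_notMem hz]
      by_cases ht : z ∈ polarCoord.target
      · rw [Set.indicator_of_mem ht, Set.indicator_of_notMem, smul_zero]
        rw [polarCoord_target] at ht
        obtain ⟨hr, h1, h2⟩ := ht
        simp only [Set.mem_Ioi] at hr
        rw [hsymm]
        rintro ⟨hx, hy⟩
        simp only [Set.mem_Ioi] at hx hy
        have hc := (mul_pos_iff_of_pos_left hr).1 hx
        have hs := (mul_pos_iff_of_pos_left hr).1 hy
        apply hz
        refine ⟨hr, ?_, ?_⟩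
        · by_contra h
          exact absurd (Real.sin_nonpos_of_nonpos_of_neg_pi_le (not_lt.1 h) h1.le) (not_le.2 hs)
        · by_contra h
          exact absurd (Real.cos_nonpos_of_pi_div_two_le_of_le (not_lt.1 h) (by linarith [Real.pi_pos]))
            (not_le.2 hc)
      · rw [Set.indicator_of_notMem ht]
  have h3 : Measurable fun θ : ℝ => ENNReal.ofReal (Real.cos θ ^ (a - 1) * Real.sin θ ^ (b - 1)) *
      F (Real.cos θ ^ 2) := by fun_prop
  rw [h1, ← lintegral_comp_polarCoord_symm, h2, Measure.volume_eq_prod, ← Measure.prod_restrict,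
    lintegral_prod_mul (f := fun ρ : ℝ => ENNReal.ofReal
      (ρ * ρ ^ (a - 1) * ρ ^ (b - 1) * Real.exp (-ρ ^ 2 / 2))) (g := fun θ : ℝ =>
      ENNReal.ofReal (Real.cos θ ^ (a - 1) * Real.sin θ ^ (b - 1)) * F (Real.cos θ ^ 2))
      (by fun_prop) h3.aemeasurable, lintegral_betaMeasure ha hb hF, mul_assoc,
    ← mul_assoc K⁻¹, ENNReal.inv_mul_cancel hK0 ENNReal.ofReal_ne_top, one_mul]

/-- The standard Gaussian law on `ℝ^ι` is invariant under orthogonal maps. -/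
theorem pi_gaussianReal_map_orthogonal {V : Matrix (Fin n) (Fin n) ℝ} (hV : V * Vᵀ = 1) :
    (Measure.pi fun _ : Fin n => gaussianReal 0 1).map (fun x => V *ᵥ x) =
      Measure.pi fun _ : Fin n => gaussianReal 0 1 := by
  have hpi : (Measure.pi fun _ : Fin n => gaussianReal 0 1) =
      (multivariateGaussian (0 : EuclideanSpace ℝ (Fin n)) 1).map WithLp.ofLp := by
    rw [multivariateGaussian_zero_one, ← map_pi_eq_stdGaussian,
      Measure.map_map (WithLp.measurable_ofLp 2 _) (WithLp.measurable_toLp 2 _)]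
    exact Measure.map_id.symm
  have hm : Measurable fun x : Fin n → ℝ => V *ᵥ x := by
    refine measurable_pi_lambda _ fun i => ?_
    simp only [Matrix.mulVec, dotProduct]
    fun_prop
  have h := multivariateGaussian_map_affine (0 : EuclideanSpace ℝ (Fin n)) Matrix.PosSemidef.one 0 V
  rw [Matrix.mul_one, hV, WithLp.ofLp_zero, Matrix.mulVec_zero, WithLp.toLp_zero, add_zero] at h
  nth_rw 2 [hpi]
  rw [← h, hpi, Measure.map_map hm (WithLp.measurable_ofLp 2 _),
    Measure.map_map (WithLp.measurable_ofLp 2 _)]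
  · congr 1
    funext x
    simp
  · simp only [zero_add]
    exact (WithLp.measurable_toLp 2 _).comp (hm.comp (WithLp.measurable_ofLp 2 _))

theorem measurable_dotProduct_self (ι : Type*) [Fintype ι] :
    Measurable fun x : ι → ℝ => x ⬝ᵥ x := by
  simp only [dotProduct]
  fun_prop

/-- The share of a block of coordinates in the squared norm of a standard Gaussian vector. -/
theorem lintegral_gaussian_share (s : Finset (Fin n)) (hs : 0 < s.card) (hsn : s.card < n)
    {F : ℝ → ℝ≥0∞} (hF : Measurable F) :
    ∫⁻ x, F ((∑ i ∈ s, x i * x i) / (x ⬝ᵥ x)) ∂(Measure.pi fun _ : Fin n => gaussianReal 0 1) =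
      ∫⁻ b, F b ∂betaMeasure ((s.card : ℝ) / 2) (((n : ℝ) - s.card) / 2) := by
  have hcard' : Fintype.card {i // i ∉ s} = n - s.card := by
    rw [Fintype.card_subtype_compl]; simp
  have hn1 : Nonempty {i // i ∈ s} := by
    obtain ⟨i, hi⟩ := Finset.card_pos.1 hs; exact ⟨⟨i, hi⟩⟩
  have hn2 : Nonempty {i // i ∉ s} := by
    rw [← Fintype.card_pos_iff, hcard']; omega
  obtain ⟨C1, hC1⟩ := exists_lintegral_dotProduct_self {i // i ∈ s}
  obtain ⟨C2, hC2⟩ := exists_lintegral_dotProduct_self {i // i ∉ s}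
  have hbn : 0 < n - s.card := by omega
  obtain ⟨C3, hC3⟩ := exists_lintegral_quadrant hs hbn
  have hcast : ((n - s.card : ℕ) : ℝ) = (n : ℝ) - s.card := Nat.cast_sub hsn.le
  rw [hcast] at hC3
  let c : ℝ := (√(2 * Real.pi))⁻¹ ^ Fintype.card (Fin n)
  have hc0 : 0 ≤ c := by positivity
  -- Proportionality with a constant independent of `F` suffices: both laws are probability
  -- measures, so `F = 1` forces `K = 1`.
  suffices hprop : ∃ K : ℝ≥0∞, ∀ F : ℝ → ℝ≥0∞, Measurable F →
      ∫⁻ x, F ((∑ i ∈ s, x i * x i) / (x ⬝ᵥ x)) ∂(Measure.pi fun _ : Fin n => gaussianReal 0 1) =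
      K * ∫⁻ b, F b ∂betaMeasure ((s.card : ℝ) / 2) (((n : ℝ) - s.card) / 2) by
    obtain ⟨K, hK⟩ := hprop
    have : IsProbabilityMeasure (betaMeasure ((s.card : ℝ) / 2) (((n : ℝ) - s.card) / 2)) :=
      isProbabilityMeasureBeta (by positivity) (by rw [← hcast]; positivity)
    have h1 := hK (fun _ => 1) measurable_const
    simp only [lintegral_one, measure_univ, mul_one] at h1
    rw [hK F hF, ← h1, one_mul]
  refine ⟨ENNReal.ofReal c * (C1 * (C2 * C3)), fun F hF => ?_⟩
  let H : ℝ → ℝ → ℝ≥0∞ := fun u v =>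
    F (u / (u + v)) * ENNReal.ofReal (Real.exp (-(u + v) / 2))
  have hH : Measurable (Function.uncurry H) := by
    simp only [H, Function.uncurry_def]; fun_prop
  have hsplit : ∀ x : Fin n → ℝ, x ⬝ᵥ x =
      (∑ i ∈ s, x i * x i) + ∑ i : {i // i ∉ s}, x i * x i := by
    intro x
    rw [dotProduct, ← Finset.sum_add_sum_compl s]
    congr 1
    exact Finset.sum_subtype _ (by simp) _
  have hm1 : Measurable fun x : Fin n → ℝ => F ((∑ i ∈ s, x i * x i) / (x ⬝ᵥ x)) := by
    simp only [dotProduct]; fun_prop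
  have hmd : Measurable fun x : Fin n → ℝ => ENNReal.ofReal (c * Real.exp (-(x ⬝ᵥ x) / 2)) := by
    simp only [dotProduct]; fun_prop
  have hmpp : MeasurePreserving (MeasurableEquiv.piEquivPiSubtypeProd (fun _ : Fin n => ℝ)
      (fun i => i ∈ s)) (volume : Measure (Fin n → ℝ))
      (volume : Measure (({i // i ∈ s} → ℝ) × ({i // i ∉ s} → ℝ))) := by
    convert volume_preserving_piEquivPiSubtypeProd (fun _ : Fin n => ℝ) (fun i => i ∈ s) <;> rfl
  calc ∫⁻ x, F ((∑ i ∈ s, x i * x i) / (x ⬝ᵥ x)) ∂(Measure.pi fun _ : Fin n => gaussianReal 0 1)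
      = ENNReal.ofReal c * ∫⁻ x : Fin n → ℝ, H (∑ i ∈ s, x i * x i) (∑ i : {i // i ∉ s}, x i * x i) := by
        rw [pi_gaussianReal_eq_withDensity, lintegral_withDensity_eq_lintegral_mul _ hmd hm1,
          ← lintegral_const_mul' _ _ ENNReal.ofReal_ne_top]
        refine lintegral_congr fun x => ?_
        simp only [Pi.mul_apply, H, ← hsplit]
        rw [ENNReal.ofReal_mul hc0]
        ring
    _ = ENNReal.ofReal c * ∫⁻ z : ({i // i ∈ s} → ℝ) × ({i // i ∉ s} → ℝ),
          H (z.1 ⬝ᵥ z.1) (z.2 ⬝ᵥ z.2) := by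
        congr 1
        have hHm : Measurable fun z : ({i // i ∈ s} → ℝ) × ({i // i ∉ s} → ℝ) =>
            H (z.1 ⬝ᵥ z.1) (z.2 ⬝ᵥ z.2) := by
          exact hH.comp (((measurable_dotProduct_self _).comp measurable_fst).prodMk
            ((measurable_dotProduct_self _).comp measurable_snd))
        rw [← hmpp.lintegral_comp (f := fun z : ({i // i ∈ s} → ℝ) × ({i // i ∉ s} → ℝ) =>
            H (z.1 ⬝ᵥ z.1) (z.2 ⬝ᵥ z.2)) hHm]
        refine lintegral_congr fun x => ?_
        congr 1
        exact Finset.sum_subtype _ (by simp) _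
    _ = ENNReal.ofReal c * ∫⁻ y : {i // i ∈ s} → ℝ, (C2 * ∫⁻ t in Set.Ioi (0 : ℝ),
          ENNReal.ofReal (t ^ (n - s.card - 1)) * H (y ⬝ᵥ y) (t ^ 2)) := by
        rw [Measure.volume_eq_prod, lintegral_prod]
        · congr 1
          refine lintegral_congr fun y => ?_
          rw [hC2 (fun v => H (y ⬝ᵥ y) v) (hH.comp measurable_prodMk_left), hcard']
        · exact (hH.comp (((measurable_dotProduct_self _).comp measurable_fst).prodMk
            ((measurable_dotProduct_self _).comp measurable_snd))).aemeasurable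
    _ = ENNReal.ofReal c * (C1 * ∫⁻ r in Set.Ioi (0 : ℝ), ENNReal.ofReal (r ^ (s.card - 1)) *
          (C2 * ∫⁻ t in Set.Ioi (0 : ℝ),
          ENNReal.ofReal (t ^ (n - s.card - 1)) * H (r ^ 2) (t ^ 2))) := by
        have hmm : Measurable fun u : ℝ => C2 * ∫⁻ t in Set.Ioi (0 : ℝ),
            ENNReal.ofReal (t ^ (n - s.card - 1)) * H u (t ^ 2) := by
          refine Measurable.const_mul (Measurable.lintegral_prod_right' (f := fun z : ℝ × ℝ =>
            ENNReal.ofReal (z.2 ^ (n - s.card - 1)) * H z.1 (z.2 ^ 2)) ?_) _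
          exact Measurable.mul (by fun_prop)
            (hH.comp (measurable_fst.prodMk (measurable_snd.pow_const 2)))
        rw [hC1 _ hmm, Fintype.card_coe]
    _ = ENNReal.ofReal c * (C1 * (C2 * ∫⁻ r in Set.Ioi (0 : ℝ), ENNReal.ofReal (r ^ (s.card - 1)) *
          ∫⁻ t in Set.Ioi (0 : ℝ),
          ENNReal.ofReal (t ^ (n - s.card - 1)) * H (r ^ 2) (t ^ 2))) := by
        have hin : Measurable fun r : ℝ => ENNReal.ofReal (r ^ (s.card - 1)) *
            ∫⁻ t in Set.Ioi (0 : ℝ), ENNReal.ofReal (t ^ (n - s.card - 1)) * H (r ^ 2) (t ^ 2) := by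
          refine Measurable.mul (by fun_prop) (Measurable.lintegral_prod_right'
            (f := fun z : ℝ × ℝ =>
              ENNReal.ofReal (z.2 ^ (n - s.card - 1)) * H (z.1 ^ 2) (z.2 ^ 2)) ?_)
          exact Measurable.mul (by fun_prop)
            (hH.comp ((measurable_fst.pow_const 2).prodMk (measurable_snd.pow_const 2)))
        rw [← lintegral_const_mul C2 hin]
        congr 2
        refine lintegral_congr fun r => ?_
        ring
    _ = _ := by
        rw [hC3 F hF]
        ring

/-! ### Null distribution of the spike statistic -/

/-- An orthogonal matrix carrying one unit vector to another. -/
theorem exists_orthogonal_mulVec_eq {c u : Fin n → ℝ} (hc : c ⬝ᵥ c = 1) (hu : u ⬝ᵥ u = 1) :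
    ∃ O : Matrix (Fin n) (Fin n) ℝ, Oᵀ * O = 1 ∧ O * Oᵀ = 1 ∧ O *ᵥ c = u := by
  by_cases hcu : c = u
  · exact ⟨1, by simp, by simp, by simp [hcu]⟩
  set w := c - u with hw
  have hw0 : w ⬝ᵥ w ≠ 0 := fun h => hcu (sub_eq_zero.1 (dotProduct_self_eq_zero.1 h))
  have hww : w ⬝ᵥ w = 2 - 2 * (c ⬝ᵥ u) := by
    rw [hw, sub_dotProduct, dotProduct_sub, dotProduct_sub, hc, hu, dotProduct_comm u c]; ring
  have hwc : w ⬝ᵥ c = (w ⬝ᵥ w) / 2 := by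
    rw [hww, hw, sub_dotProduct, hc, dotProduct_comm u c]; ring
  -- The Householder reflection along `w = c - u`; since `w·c` is half of `w·w`, it sends `c` to `c
  -- - w = u`.
  let O : Matrix (Fin n) (Fin n) ℝ := 1 - (2 / (w ⬝ᵥ w)) • vecMulVec w w
  have hOt : Oᵀ = O := by
    simp [O, Matrix.transpose_sub, Matrix.transpose_smul, Matrix.transpose_vecMulVec]
  have hOO : O * O = 1 := by
    have h1 : vecMulVec w w * vecMulVec w w = (w ⬝ᵥ w) • vecMulVec w w := by
      rw [Matrix.vecMulVec_mul_vecMulVec, Matrix.vecMulVec_smul]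
    simp only [O, Matrix.mul_sub, Matrix.sub_mul, Matrix.mul_one, Matrix.one_mul, Matrix.smul_mul,
      Matrix.mul_smul, h1, smul_smul]
    ext i j
    simp only [Matrix.sub_apply, Matrix.smul_apply, smul_eq_mul]
    field_simp
    ring
  refine ⟨O, by rw [hOt, hOO], by rw [hOt, hOO], ?_⟩
  rw [Matrix.sub_mulVec, Matrix.one_mulVec, Matrix.smul_mulVec, Matrix.vecMulVec_mulVec, hwc]
  ext i
  have h2 : (2 / (w ⬝ᵥ w)) * ((w ⬝ᵥ w) / 2) = 1 := by field_simp
  have h3 : w i = c i - u i := rfl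
  simp only [Pi.sub_apply, Pi.smul_apply, MulOpposite.smul_eq_mul_unop, MulOpposite.unop_op,
    smul_eq_mul]
  linear_combination (-(w i)) * h2 - h3

theorem ae_matrixNormal_one {P : Matrix (Fin n) (Fin p) ℝ → Prop}
    (hP : ∀ᵐ Y ∂matrixVolume n p, P Y) : ∀ᵐ Y ∂matrixNormal 0 1 1, P Y := by
  obtain ⟨c, -, -, hc⟩ := exists_lintegral_matrixNormal_one n p
  obtain ⟨t, hsub, ht, ht0⟩ := exists_measurable_superset_of_null (ae_iff.1 hP)
  rw [ae_iff]
  refine measure_mono_null hsub ?_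
  rw [← lintegral_indicator_one ht, hc _ (measurable_one.indicator ht), lintegral_eq_zero_of_ae_eq_zero,
    mul_zero]
  filter_upwards [measure_eq_zero_iff_ae_notMem.1 ht0] with Y hY
  simp [hY]

theorem matrixNormal_one_map_orthogonal {O : Matrix (Fin n) (Fin n) ℝ} (hO : O * Oᵀ = 1) :
    (matrixNormal (0 : Matrix (Fin n) (Fin p) ℝ) 1 1).map (fun Y => O * Y) =
      matrixNormal 0 1 1 := by
  have h := matrixNormal_map_affine (0 : Matrix (Fin n) (Fin p) ℝ) Matrix.PosSemidef.one
    Matrix.PosSemidef.one 0 O (1 : Matrix (Fin p) (Fin p) ℝ)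
  simpa [hO] using h

theorem dotProduct_mulVec_conj (O : Matrix (Fin m) (Fin n) ℝ) (G : Matrix (Fin m) (Fin m) ℝ)
    (c : Fin n → ℝ) :
    (O *ᵥ c) ⬝ᵥ (G *ᵥ (O *ᵥ c)) = c ⬝ᵥ ((Oᵀ * G * O) *ᵥ c) := by
  rw [← Matrix.mulVec_mulVec, ← Matrix.mulVec_mulVec, Matrix.dotProduct_mulVec c Oᵀ,
    Matrix.vecMul_transpose]

/-- The null distribution of the spike statistic. -/
theorem lintegral_spikeStat (hp : 0 < p) (hpn : p < n) {c : Fin n → ℝ} (hc : c ⬝ᵥ c = 1)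
    {F : ℝ → ℝ≥0∞} (hF : Measurable F) :
    ∫⁻ Y, F (spikeStat p c Y) ∂matrixNormal 0 1 1 =
      ∫⁻ b, F b ∂betaMeasure ((p : ℝ) / 2) (((n : ℝ) - p) / 2) := by
  have hn : Nonempty (Fin n) := ⟨⟨0, by omega⟩⟩
  let γ := Measure.pi fun _ : Fin n => gaussianReal 0 1
  let Q : (Fin n → ℝ) → Matrix (Fin n) (Fin p) ℝ → ℝ := fun g Y =>
    (g ⬝ᵥ (grass Y *ᵥ g)) / (g ⬝ᵥ g)
  have hγ0 : ∀ᵐ g ∂γ, g ≠ 0 := by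
    have hac : γ ≪ volume := by
      rw [show γ = _ from pi_gaussianReal_eq_withDensity (Fin n)]
      exact withDensity_absolutelyContinuous _ _
    exact hac.ae_le (Measure.ae_ne volume 0)
  have hQm : Measurable (Function.uncurry Q) := by
    simp only [Q, Function.uncurry_def, dotProduct, Matrix.mulVec]
    refine Measurable.div (Finset.measurable_sum _ fun i _ => Measurable.mul (by fun_prop)
      (Finset.measurable_sum _ fun j _ => Measurable.mul ?_ (by fun_prop))) (by fun_prop)
    exact (measurable_matrix_iff.1 measurable_grass i j).comp measurable_snd
  -- For fixed `g ≠ 0`, a rotation taking `c` to `g/|g|` is absorbed by the rotation invariance of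
  -- the law of `Y`.
  have h1 : ∀ᵐ g ∂γ, ∫⁻ Y, F (Q g Y) ∂matrixNormal 0 1 1 =
      ∫⁻ Y, F (spikeStat p c Y) ∂matrixNormal 0 1 1 := by
    filter_upwards [hγ0] with g hg
    have hgg : 0 < g ⬝ᵥ g := lt_of_le_of_ne (Finset.sum_nonneg fun i _ => mul_self_nonneg _)
      fun h => hg (dotProduct_self_eq_zero.1 h.symm)
    set r := √(g ⬝ᵥ g) with hr
    have hr0 : r ≠ 0 := (Real.sqrt_pos.2 hgg).ne'
    have hrr : r * r = g ⬝ᵥ g := Real.mul_self_sqrt hgg.le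
    obtain ⟨O, hO1, hO2, hOc⟩ := exists_orthogonal_mulVec_eq hc (u := r⁻¹ • g) (by
      rw [smul_dotProduct, dotProduct_smul, ← hrr, smul_eq_mul, smul_eq_mul]; field_simp)
    have hg' : g = r • (O *ᵥ c) := by rw [hOc, smul_smul, mul_inv_cancel₀ hr0, one_smul]
    have hQ : ∀ Y, Q g Y = spikeStat p c (Oᵀ * Y) := by
      intro Y
      rw [spikeStat_eq, grass_orthogonal_mul (by rw [Matrix.transpose_transpose, hO2]),
        Matrix.transpose_transpose, ← dotProduct_mulVec_conj]
      show (g ⬝ᵥ (grass Y *ᵥ g)) / (g ⬝ᵥ g) = _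
      rw [← hrr]
      nth_rw 1 2 [hg']
      rw [Matrix.mulVec_smul, smul_dotProduct, dotProduct_smul, smul_eq_mul, smul_eq_mul]
      field_simp
    simp only [hQ]
    have hFm : Measurable fun Y => F (spikeStat p c Y) := hF.comp (measurable_spikeStat c)
    conv_rhs => rw [← matrixNormal_one_map_orthogonal (O := Oᵀ)
      (by rw [Matrix.transpose_transpose, hO1])]
    exact (lintegral_map hFm (measurable_matrix_mul measurable_const measurable_id)).symm
  -- For fixed `Y` of full rank, `grass Y` is a rank-`p` projection. Diagonalizing it and rotating
  -- `g` makes `Q g Y` the share of `p` coordinates in `|g|²`.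
  have h2 : ∀ᵐ Y ∂matrixNormal 0 1 1, ∫⁻ g, F (Q g Y) ∂γ =
      ∫⁻ b, F b ∂betaMeasure ((p : ℝ) / 2) (((n : ℝ) - p) / 2) := by
    filter_upwards [ae_matrixNormal_one (ae_det_gram_ne_zero hpn.le)] with Y hY
    obtain ⟨V, s, hV1, hV2, hG, hs⟩ := exists_orthogonal_diagonalization (grass_transpose Y)
      (grass_mul_grass Y)
    have hsp : s.card = p := by
      rw [trace_grass hY] at hs; exact_mod_cast hs
    have hmain := lintegral_gaussian_share s (by omega) (by omega) hF
    rw [hsp] at hmain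
    have hmap := pi_gaussianReal_map_orthogonal (V := Vᵀ) (by rw [Matrix.transpose_transpose, hV1])
    have hmm : Measurable fun x : Fin n → ℝ => F ((∑ i ∈ s, x i * x i) / (x ⬝ᵥ x)) := by
      simp only [dotProduct]; fun_prop
    have hmV : Measurable fun x : Fin n → ℝ => Vᵀ *ᵥ x := by
      refine measurable_pi_lambda _ fun i => ?_
      simp only [Matrix.mulVec, dotProduct]
      fun_prop
    rw [← hmain, ← hmap, lintegral_map hmm hmV]
    refine lintegral_congr fun g => ?_
    congr 1
    show (g ⬝ᵥ (grass Y *ᵥ g)) / (g ⬝ᵥ g) = _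
    congr 1
    · have h := dotProduct_mulVec_conj Vᵀ (diagonal fun i => if i ∈ s then (1 : ℝ) else 0) g
      rw [Matrix.transpose_transpose, ← hG] at h
      rw [← h, dotProduct]
      simp [Matrix.mulVec_diagonal, Finset.sum_ite_mem]
    · have h := dotProduct_mulVec_conj Vᵀ 1 g
      rw [Matrix.transpose_transpose, Matrix.mul_one, hV2, Matrix.one_mulVec,
        Matrix.one_mulVec] at h
      exact h.symm
  have hFQ : Measurable (Function.uncurry fun g Y => F (Q g Y)) := hF.comp hQm
  have hswap := lintegral_lintegral_swap (μ := γ) (ν := matrixNormal (0 : Matrix (Fin n) (Fin p) ℝ) 1 1)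
    (f := fun g Y => F (Q g Y)) hFQ.aemeasurable
  rw [lintegral_congr_ae h1, lintegral_congr_ae h2] at hswap
  simpa using hswap

theorem measurable_mul_left (L : Matrix (Fin m) (Fin n) ℝ) :
    Measurable fun Y : Matrix (Fin n) (Fin p) ℝ => L * Y :=
  measurable_matrix_mul measurable_const measurable_id

theorem measurable_mul_right (R : Matrix (Fin p) (Fin k) ℝ) :
    Measurable fun Y : Matrix (Fin n) (Fin p) ℝ => Y * R :=
  measurable_matrix_mul measurable_id measurable_const

/-! ### Quantiles and tails of the beta law -/

/-- A law without atoms gives mass exactly `u` to the half-line below its `u`-quantile. -/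
theorem measureReal_Iic_quantile (μ : Measure ℝ) [IsProbabilityMeasure μ] (hμ : ∀ x, μ {x} = 0)
    {u : ℝ} (hu : u ∈ Set.Ioo (0 : ℝ) 1) : μ.real (Set.Iic (quantile μ u)) = u := by
  set A : Set ℝ := {x : ℝ | u ≤ μ.real (Set.Iic x)} with hA
  have hmem : ∀ x, x ∈ A ↔ u ≤ cdf μ x := fun x => by rw [cdf_eq_real]; rfl
  have hne : A.Nonempty := by
    obtain ⟨x, hx⟩ := ((tendsto_cdf_atTop μ).eventually (lt_mem_nhds hu.2)).exists
    exact ⟨x, (hmem x).2 hx.le⟩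
  have hbdd : BddBelow A := by
    obtain ⟨x, hx⟩ := ((tendsto_cdf_atBot μ).eventually (gt_mem_nhds hu.1)).exists
    refine ⟨x, fun y hy => ?_⟩
    by_contra h
    exact absurd ((hmem y).1 hy) (not_le.2 (((cdf μ).mono (not_le.1 h).le).trans_lt hx))
  have hq : quantile μ u = sInf A := rfl
  rw [hq, ← cdf_eq_real]
  apply le_antisymm
  -- The absence of atoms excludes a jump at the quantile, so the bound `cdf < u` to its left passes
  -- to the limit.
  · have hleft : cdf μ (sInf A) ≤ Function.leftLim (cdf μ) (sInf A) := by
      have h := hμ (sInf A)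
      rw [← measure_cdf (μ := μ), StieltjesFunction.measure_singleton, ENNReal.ofReal_eq_zero] at h
      linarith
    refine hleft.trans (le_of_tendsto ((cdf μ).mono.tendsto_leftLim _) ?_)
    filter_upwards [self_mem_nhdsWithin] with x hx
    by_contra h
    exact absurd (csInf_le hbdd ((hmem x).2 (not_le.1 h).le)) (not_le.2 hx)
  · have h := ((cdf μ).right_continuous (sInf A)).mono_left
      (nhdsWithin_mono _ Set.Ioi_subset_Ici_self)
    refine ge_of_tendsto h ?_
    filter_upwards [self_mem_nhdsWithin] with x hx
    obtain ⟨y, hy, hyx⟩ := (csInf_lt_iff hbdd hne).1 hx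
    exact ((hmem y).1 hy).trans ((cdf μ).mono hyx.le)

theorem betaMeasure_ae_mem_Ioo (a b : ℝ) : ∀ᵐ x ∂betaMeasure a b, x ∈ Set.Ioo (0 : ℝ) 1 := by
  have hm : Measurable (betaPDF a b) := (measurable_betaPDFReal _ _).ennreal_ofReal
  rw [betaMeasure, ae_withDensity_iff hm]
  refine ae_of_all _ fun x hx => ?_
  by_contra h
  exact hx (by rw [betaPDF_eq, if_neg (show ¬(0 < x ∧ x < 1) from h), ENNReal.ofReal_zero])

/-- The upper tail at the quantile of a beta law, and the range of that quantile. -/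
theorem betaMeasure_quantile {a b α : ℝ} (ha : 0 < a) (hb : 0 < b) (hα : 0 < α ∧ α < 1) :
    (betaMeasure a b).real {x | quantile (betaMeasure a b) (1 - α) < x} = α ∧
      quantile (betaMeasure a b) (1 - α) ∈ Set.Icc (0 : ℝ) 1 := by
  have := isProbabilityMeasureBeta ha hb
  have hatom : ∀ x, betaMeasure a b {x} = 0 := fun x =>
    withDensity_absolutelyContinuous _ _ (by simp)
  have h := measureReal_Iic_quantile (betaMeasure a b) hatom (u := 1 - α)
    ⟨by linarith [hα.2], by linarith [hα.1]⟩
  set q := quantile (betaMeasure a b) (1 - α)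
  refine ⟨?_, ?_, ?_⟩
  · have hcompl : {x | q < x} = (Set.Iic q)ᶜ := by ext x; simp
    rw [hcompl, measureReal_compl measurableSet_Iic, h]
    simp
  · by_contra hq
    have h0 : betaMeasure a b (Set.Iic q) = 0 := by
      rw [measure_eq_zero_iff_ae_notMem]
      filter_upwards [betaMeasure_ae_mem_Ioo a b] with x hx hxq
      exact hq (hx.1.le.trans hxq)
    rw [Measure.real, h0, ENNReal.toReal_zero] at h
    linarith [hα.2]
  -- The point `1` lies in the set whose infimum is the quantile; negative points have no mass below
  -- them, so that set is bounded below by `0`.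
  · by_contra hq
    have hs : (1 : ℝ) ∈ {x : ℝ | 1 - α ≤ (betaMeasure a b).real (Set.Iic x)} := by
      have h1 : (betaMeasure a b) (Set.Iic 1) = 1 := by
        rw [prob_compl_eq_zero_iff measurableSet_Iic |>.symm, measure_eq_zero_iff_ae_notMem]
        filter_upwards [betaMeasure_ae_mem_Ioo a b] with x hx hx1
        exact hx1 hx.2.le
      rw [Set.mem_ofPred_eq, Measure.real, h1, ENNReal.toReal_one]
      linarith [hα.1]
    refine hq (csInf_le ?_ hs)
    refine ⟨0, fun y hy => ?_⟩
    by_contra hy0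
    have h0 : betaMeasure a b (Set.Iic y) = 0 := by
      rw [measure_eq_zero_iff_ae_notMem]
      filter_upwards [betaMeasure_ae_mem_Ioo a b] with x hx hxq
      exact hy0 (hx.1.le.trans hxq)
    rw [Set.mem_ofPred_eq, Measure.real, h0, ENNReal.toReal_zero] at hy
    linarith [hα.2]

theorem betaMeasure_spiked_tail {a b ω t : ℝ} (hω : 0 ≤ ω) (ht : t ≤ 1) :
    (betaMeasure a b).real {x | (1 + ω) / (1 + x * ω) * x > t} =
      (betaMeasure a b).real {x | x > t / (1 + ω * (1 - t))} := by
  apply measureReal_congr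
  filter_upwards [betaMeasure_ae_mem_Ioo a b] with x hx
  apply propext
  show (1 + ω) / (1 + x * ω) * x > t ↔ x > t / (1 + ω * (1 - t))
  have h1 : 0 < 1 + x * ω := by nlinarith [hx.1, mul_nonneg hx.1.le hω]
  have h2 : 0 < 1 + ω * (1 - t) := by nlinarith [mul_nonneg hω (sub_nonneg.2 ht)]
  rw [gt_iff_lt, gt_iff_lt, div_mul_eq_mul_div, lt_div_iff₀ h1, div_lt_iff₀ h2]
  constructor <;> intro h <;> nlinarith

/-! ### The spiked covariance and the law of the statistic under it -/

theorem rankOne_transpose (c : Fin n → ℝ) (a : ℝ) :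
    (a • vecMulVec c c + 1)ᵀ = a • vecMulVec c c + 1 := by
  simp [Matrix.transpose_add, Matrix.transpose_smul, Matrix.transpose_vecMulVec]

theorem rankOne_mul {c : Fin n → ℝ} (hc : c ⬝ᵥ c = 1) (a b : ℝ) :
    (a • vecMulVec c c + 1) * (b • vecMulVec c c + 1) =
      (a + b + a * b) • vecMulVec c c + 1 := by
  have h1 : vecMulVec c c * vecMulVec c c = vecMulVec c c := by
    rw [Matrix.vecMulVec_mul_vecMulVec, hc, one_smul]
  simp only [Matrix.mul_add, Matrix.add_mul, Matrix.mul_one, Matrix.one_mul, Matrix.smul_mul,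
    Matrix.mul_smul, h1]
  module

/-- The symmetric square root of the spiked covariance and its inverse. -/
theorem exists_spikedCov_factor {c : Fin n → ℝ} (hc : c ⬝ᵥ c = 1) {ω : ℝ} (hω : 0 ≤ ω) :
    ∃ L N : Matrix (Fin n) (Fin n) ℝ, L * Lᵀ = spikedCov c ω ∧
      Lᵀ * L = ω • vecMulVec c c + 1 ∧ Nᵀ * N = (-(ω / (1 + ω))) • vecMulVec c c + 1 ∧
      N * L = 1 := by
  set s := √(1 + ω) with hs
  have hs0 : s ≠ 0 := (Real.sqrt_pos.2 (by linarith)).ne'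
  have hss : s * s = 1 + ω := Real.mul_self_sqrt (by linarith)
  -- These matrices have eigenvalue `s` and `s⁻¹` respectively on `c`, and act as the identity on
  -- its orthogonal complement.
  refine ⟨(s - 1) • vecMulVec c c + 1, (s⁻¹ - 1) • vecMulVec c c + 1, ?_, ?_, ?_, ?_⟩
  · rw [rankOne_transpose, rankOne_mul hc, spikedCov]
    congr 2
    linear_combination hss
  · rw [rankOne_transpose, rankOne_mul hc]
    congr 2
    linear_combination hss
  · rw [rankOne_transpose, rankOne_mul hc]
    congr 2
    rw [← hss]
    field_simp
    linear_combination -hss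
  · rw [rankOne_mul hc]
    have : s⁻¹ - 1 + (s - 1) + (s⁻¹ - 1) * (s - 1) = 0 := by field_simp; ring
    rw [this, zero_smul, zero_add]

theorem posSemidef_spikedCov {c : Fin n → ℝ} {ω : ℝ} (hω : 0 ≤ ω) :
    (spikedCov c ω).PosSemidef := by
  refine Matrix.PosSemidef.add (Matrix.PosSemidef.smul ?_ hω) Matrix.PosSemidef.one
  simpa using Matrix.posSemidef_vecMulVec_self_star c

@[simp] theorem spikedCov_zero (c : Fin n → ℝ) : spikedCov c 0 = 1 := by simp [spikedCov]

/-- Expectations of invariant functions do not depend on the column covariance. -/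
theorem integral_matrixNormal_of_invariant {ψ : Matrix (Fin n) (Fin p) ℝ → ℝ}
    (hψm : Measurable ψ) (hψ : ∀ A : Matrix (Fin p) (Fin p) ℝ, A.det ≠ 0 → ∀ Y, ψ (Y * A) = ψ Y)
    {S : Matrix (Fin p) (Fin p) ℝ} (hS : S.PosDef) {Ψ : Matrix (Fin n) (Fin n) ℝ}
    (hΨ : Ψ.PosSemidef) :
    ∫ Y, ψ Y ∂matrixNormal 0 S Ψ = ∫ Y, ψ Y ∂matrixNormal 0 1 Ψ := by
  obtain ⟨T, hT⟩ := CStarAlgebra.nonneg_iff_eq_star_mul_self.1 hS.posSemidef.nonneg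
  rw [Matrix.star_eq_conjTranspose, Matrix.conjTranspose_eq_transpose_of_trivial] at hT
  have hTd : T.det ≠ 0 := by
    intro h0
    have := hS.det_pos
    rw [hT, Matrix.det_mul, h0, mul_zero] at this
    exact lt_irrefl _ this
  have h := matrixNormal_map_affine (0 : Matrix (Fin n) (Fin p) ℝ)
    (Matrix.PosSemidef.one (n := Fin p) (R := ℝ)) hΨ 0
    (1 : Matrix (Fin n) (Fin n) ℝ) Tᵀ
  simp only [Matrix.mul_zero, Matrix.zero_mul, zero_add, Matrix.mul_one, Matrix.one_mul,
    Matrix.transpose_transpose, Matrix.transpose_one, ← hT] at h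
  rw [← h, integral_map (measurable_mul_right T).aemeasurable
    hψm.aestronglyMeasurable]
  exact integral_congr_ae (ae_of_all _ fun Y => hψ T hTd Y)

theorem map_spikeStat (hp : 0 < p) (hpn : p < n) {c : Fin n → ℝ} (hc : c ⬝ᵥ c = 1) :
    (matrixNormal (0 : Matrix (Fin n) (Fin p) ℝ) 1 1).map (spikeStat p c) =
      betaMeasure ((p : ℝ) / 2) (((n : ℝ) - p) / 2) := by
  refine Measure.ext_of_lintegral _ fun F hF => ?_
  rw [lintegral_map hF (measurable_spikeStat c), lintegral_spikeStat hp hpn hc hF]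

/-- Passing from `Y` to `LY` and back by `N` multiplies the Gram determinant by `1 + ωt` and then by
`1 - ωt'/(1+ω)`, with `t` and `t'` the statistics of `Y` and `LY`. The product is `1`, which is
solved for `t'`; the solution divides by `ω`. -/
theorem spikeStat_mul {c : Fin n → ℝ} {ω : ℝ} (hω : 0 ≤ ω) (hc : c ⬝ᵥ c = 1)
    {L N : Matrix (Fin n) (Fin n) ℝ} (hL : Lᵀ * L = ω • vecMulVec c c + 1)
    (hN : Nᵀ * N = (-(ω / (1 + ω))) • vecMulVec c c + 1) (hNL : N * L = 1)
    (hω0 : ω ≠ 0) {Y : Matrix (Fin n) (Fin p) ℝ} (hY : (Yᵀ * Y).det ≠ 0) :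
    spikeStat p c (L * Y) =
      (1 + ω) / (1 + spikeStat p c Y * ω) * spikeStat p c Y := by
  have hLd : L.det ≠ 0 := by
    intro h0
    have := congrArg Matrix.det hNL
    rw [Matrix.det_mul, h0, mul_zero, Matrix.det_one] at this
    exact zero_ne_one this
  have h1 := det_gram_mul hL hY
  have h2 := det_gram_mul hN (det_gram_mul_left_ne_zero hLd hY)
  rw [← Matrix.mul_assoc N, hNL, Matrix.one_mul, h1] at h2
  have h3 := (spikeStat_mem_Icc hc Y).1
  set t := spikeStat p c Y
  set t' := spikeStat p c (L * Y)
  have h4 : 0 < 1 + t * ω := by positivity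
  have h5 : (1 + ω * t) * (1 + -(ω / (1 + ω)) * t') = 1 := by
    rw [mul_assoc] at h2
    exact mul_left_cancel₀ hY (h2.symm.trans (mul_one _).symm)
  have h6 : 1 + ω ≠ 0 := by positivity
  field_simp at h5 ⊢
  have : ω * (t' * (1 + ω * t)) = ω * (t * (1 + ω)) := by linear_combination -h5
  have := mul_left_cancel₀ hω0 this
  linear_combination this

theorem map_spikeStat_spikedCov (hp : 0 < p) (hpn : p < n) {c : Fin n → ℝ} (hc : c ⬝ᵥ c = 1) {ω : ℝ}
    (hω : 0 ≤ ω) :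
    (matrixNormal (0 : Matrix (Fin n) (Fin p) ℝ) 1 (spikedCov c ω)).map (spikeStat p c) =
      (betaMeasure ((p : ℝ) / 2) (((n : ℝ) - p) / 2)).map
        fun b => (1 + ω) / (1 + b * ω) * b := by
  rcases eq_or_ne ω 0 with rfl | hω0
  · rw [spikedCov_zero, map_spikeStat hp hpn hc]
    simp [Measure.map_id']
  obtain ⟨L, N, hLL, hL, hN, hNL⟩ := exists_spikedCov_factor hc hω
  have h := matrixNormal_map_affine (0 : Matrix (Fin n) (Fin p) ℝ)
    (Matrix.PosSemidef.one (n := Fin p) (R := ℝ)) (Matrix.PosSemidef.one (n := Fin n) (R := ℝ)) 0 L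
    (1 : Matrix (Fin p) (Fin p) ℝ)
  simp only [Matrix.mul_zero, zero_add, Matrix.mul_one, Matrix.transpose_one, hLL] at h
  have hm : Measurable fun b : ℝ => (1 + ω) / (1 + b * ω) * b := by fun_prop
  rw [← h, ← map_spikeStat hp hpn hc, Measure.map_map (measurable_spikeStat c)
    (measurable_mul_left L), Measure.map_map hm
    (measurable_spikeStat c)]
  refine Measure.map_congr ?_
  filter_upwards [ae_matrixNormal_one (ae_det_gram_ne_zero hpn.le)] with Y hY
  exact spikeStat_mul hω hc hL hN hNL hω0 hY

/-! ### Likelihood ratio, Neyman–Pearson and the mean-zero model -/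

theorem measurable_rejectAbove {𝓨 : Type*} [MeasurableSpace 𝓨] {t : 𝓨 → ℝ} (ht : Measurable t)
    (b : ℝ) : Measurable (rejectAbove t b) :=
  measurable_const.indicator (ht measurableSet_Ioi)

theorem rejectAbove_mem_Icc {𝓨 : Type*} (t : 𝓨 → ℝ) (b : ℝ) (y : 𝓨) :
    rejectAbove t b y ∈ Set.Icc (0 : ℝ) 1 := by
  simp only [rejectAbove, Set.indicator_apply]
  split_ifs <;> simp

theorem rejectAbove_spikeStat_mul (c : Fin n → ℝ) (b : ℝ) (A : Matrix (Fin p) (Fin p) ℝ)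
    (hA : A.det ≠ 0) (Y : Matrix (Fin n) (Fin p) ℝ) :
    rejectAbove (spikeStat p c) b (Y * A) = rejectAbove (spikeStat p c) b Y := by
  simp only [rejectAbove, Set.indicator_apply, Set.mem_ofPred_eq, spikeStat_eq,
    grass_mul_right Y (isUnit_iff_ne_zero.2 hA)]

theorem integral_rejectAbove {𝓨 : Type*} [MeasurableSpace 𝓨] (μ : Measure 𝓨) {t : 𝓨 → ℝ}
    (ht : Measurable t) (b : ℝ) :
    ∫ y, rejectAbove t b y ∂μ = (μ.map t).real {x | b < x} := by
  have hs : MeasurableSet {y | b < t y} := ht measurableSet_Ioi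
  rw [rejectAbove, integral_indicator hs, setIntegral_const, smul_eq_mul, mul_one]
  exact (map_measureReal_apply ht measurableSet_Ioi).symm

/-- The likelihood ratio of the invariant σ-algebra under a rank-one spike is an explicit increasing
function of the spike statistic. -/
theorem exists_lintegral_spikedCov (hpn : p ≤ n) {c : Fin n → ℝ} (hc : c ⬝ᵥ c = 1) {ω : ℝ}
    (hω : 0 ≤ ω) : ∃ K : ℝ≥0∞, ∀ F : Matrix (Fin n) (Fin p) ℝ → ℝ≥0∞, Measurable F →
      (∀ A : Matrix (Fin p) (Fin p) ℝ, A.det ≠ 0 → ∀ Y, F (Y * A) = F Y) →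
      ∫⁻ Y, F Y ∂matrixNormal 0 1 (spikedCov c ω) =
        K * ∫⁻ Y, F Y * ENNReal.ofReal ((√(1 - ω / (1 + ω) * spikeStat p c Y))⁻¹ ^ n)
          ∂matrixNormal 0 1 1 := by
  obtain ⟨L, N, hLL, hL, hN, hNL⟩ := exists_spikedCov_factor hc hω
  obtain ⟨C, hC0, hCt, hC⟩ := exists_lintegral_matrixNormal_one n p
  have hdet : N.det * L.det = 1 := by rw [← Matrix.det_mul, hNL, Matrix.det_one]
  have hLd : L.det ≠ 0 := right_ne_zero_of_mul_eq_one hdet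
  have hNd : N.det ≠ 0 := left_ne_zero_of_mul_eq_one hdet
  have hLN : L * N = 1 := mul_eq_one_comm.1 hNL
  have hone : (1 : Matrix (Fin p) (Fin p) ℝ).det ≠ 0 := by rw [Matrix.det_one]; exact one_ne_zero
  -- The constant is the Jacobian of `Y ↦ NY`, the substitution that moves the spike from the
  -- argument of `F` to the Gaussian weight.
  refine ⟨ENNReal.ofReal (|N.det| ^ p * |(1 : Matrix (Fin p) (Fin p) ℝ).det| ^ n),
    fun F hFm hF => ?_⟩
  have h := matrixNormal_map_affine (0 : Matrix (Fin n) (Fin p) ℝ)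
    (Matrix.PosSemidef.one (n := Fin p) (R := ℝ)) (Matrix.PosSemidef.one (n := Fin n) (R := ℝ)) 0 L
    (1 : Matrix (Fin p) (Fin p) ℝ)
  simp only [Matrix.mul_zero, zero_add, Matrix.mul_one, Matrix.transpose_one, hLL] at h
  have hLm : Measurable fun Y : Matrix (Fin n) (Fin p) ℝ => L * Y :=
    measurable_mul_left L
  have hρm : Measurable fun Y : Matrix (Fin n) (Fin p) ℝ =>
      ENNReal.ofReal ((√(1 - ω / (1 + ω) * spikeStat p c Y))⁻¹ ^ n) :=
    ENNReal.measurable_ofReal.comp ((Real.continuous_sqrt.measurable.comp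
      (((measurable_spikeStat c).const_mul _).const_sub _)).inv.pow_const n)
  rw [← h, lintegral_map hFm hLm, hC (fun Y => F (L * Y)) (hFm.comp hLm),
    hC (fun Y => F Y * ENNReal.ofReal ((√(1 - ω / (1 + ω) * spikeStat p c Y))⁻¹ ^ n))
      (hFm.mul hρm),
    lintegral_matrixVolume_mul_mul hNd hone
      (F := fun Y => F (L * Y) * gaussWeight Y) ((hFm.comp hLm).mul measurable_gaussWeight)]
  simp only [Matrix.mul_one, ← Matrix.mul_assoc, hLN, Matrix.one_mul]
  rw [lintegral_invariant hpn hFm hF hNd, mul_left_comm]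
  congr 2
  refine lintegral_congr_ae ?_
  filter_upwards [ae_det_gram_ne_zero hpn] with Y hY
  obtain ⟨T, -, hT0, hTq⟩ := exists_gram_factor hY
  have hq0 : gramVol Y ≠ 0 := by rw [← hTq]; exact abs_ne_zero.2 hT0
  have hdpos : 0 ≤ (Yᵀ * Y).det := by
    by_contra hneg
    exact hq0 (Real.sqrt_eq_zero_of_nonpos (not_le.1 hneg).le)
  have hqN : gramVol (N * Y) = gramVol Y * √(1 - ω / (1 + ω) * spikeStat p c Y) := by
    rw [gramVol, det_gram_mul hN hY, Real.sqrt_mul hdpos, neg_mul, ← sub_eq_add_neg]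
    rfl
  rw [hqN, div_mul_eq_div_div, div_self hq0, one_div]

/-- Neyman-Pearson for the invariant tests of the rank-one spike. -/
theorem integral_le_of_invariant_level (hpn : p < n) {c : Fin n → ℝ} (hc : c ⬝ᵥ c = 1)
    {ω α b : ℝ} (hω : 0 < ω) (hb : b ≤ 1)
    (hφ : ∫ Y, rejectAbove (spikeStat p c) b Y ∂matrixNormal 0 1 1 = α)
    {ψ : Matrix (Fin n) (Fin p) ℝ → ℝ} (hψm : Measurable ψ) (hψ01 : ∀ Y, ψ Y ∈ Set.Icc (0 : ℝ) 1)
    (hψ : ∀ A : Matrix (Fin p) (Fin p) ℝ, A.det ≠ 0 → ∀ Y, ψ (Y * A) = ψ Y)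
    (hψα : ∫ Y, ψ Y ∂matrixNormal 0 1 1 ≤ α) :
    ∫ Y, ψ Y ∂matrixNormal 0 1 (spikedCov c ω) ≤
      ∫ Y, rejectAbove (spikeStat p c) b Y ∂matrixNormal 0 1 (spikedCov c ω) := by
  set φ := rejectAbove (spikeStat p c) b with hφdef
  have hφm : Measurable φ := measurable_rejectAbove (measurable_spikeStat c) b
  have hφ01 : ∀ Y, φ Y ∈ Set.Icc (0 : ℝ) 1 := rejectAbove_mem_Icc _ _
  have hφinv : ∀ A : Matrix (Fin p) (Fin p) ℝ, A.det ≠ 0 → ∀ Y, φ (Y * A) = φ Y :=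
    rejectAbove_spikeStat_mul c b
  have hconv : ∀ {χ : Matrix (Fin n) (Fin p) ℝ → ℝ}, Measurable χ → (∀ Y, χ Y ∈ Set.Icc (0 : ℝ) 1) →
      ∀ μ : Measure (Matrix (Fin n) (Fin p) ℝ), IsProbabilityMeasure μ →
      ENNReal.ofReal (∫ Y, χ Y ∂μ) = ∫⁻ Y, ENNReal.ofReal (χ Y) ∂μ := by
    intro χ hm h01 μ _
    refine ofReal_integral_eq_lintegral_ofReal ?_ (ae_of_all _ fun Y => (h01 Y).1)
    refine Integrable.of_bound hm.aestronglyMeasurable 1 (ae_of_all _ fun Y => ?_)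
    rw [Real.norm_eq_abs, abs_of_nonneg (h01 Y).1]
    exact (h01 Y).2
  set κ := ω / (1 + ω) with hκ
  have hκ0 : 0 < κ := by positivity
  have hκ1 : κ < 1 := by rw [hκ, div_lt_one (by linarith)]; linarith
  let ρ : ℝ → ℝ≥0∞ := fun t => ENNReal.ofReal ((√(1 - κ * t))⁻¹ ^ n)
  -- Since `κ < 1`, the square root stays positive up to `t = 1`. Monotonicity is used only there,
  -- hence the requirement `b ≤ 1`.
  have hρ : ∀ {s t : ℝ}, s ≤ t → t ≤ 1 → ρ s ≤ ρ t := by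
    intro s t hst ht
    apply ENNReal.ofReal_le_ofReal
    have : 0 < √(1 - κ * t) := Real.sqrt_pos.2 (by nlinarith)
    gcongr
  have hρm : Measurable fun Y : Matrix (Fin n) (Fin p) ℝ => ρ (spikeStat p c Y) :=
    ENNReal.measurable_ofReal.comp ((Real.continuous_sqrt.measurable.comp
      (((measurable_spikeStat c).const_mul _).const_sub _)).inv.pow_const n)
  obtain ⟨K, hK⟩ := exists_lintegral_spikedCov hpn.le hc hω.le
  have hφψ : ENNReal.ofReal (∫ Y, ψ Y ∂matrixNormal 0 1 (spikedCov c ω)) ≤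
      ENNReal.ofReal (∫ Y, φ Y ∂matrixNormal 0 1 (spikedCov c ω)) := by
    rw [hconv hψm hψ01 _ inferInstance, hconv hφm hφ01 _ inferInstance,
      hK _ hψm.ennreal_ofReal (fun A hA Y => by rw [hψ A hA]),
      hK _ hφm.ennreal_ofReal (fun A hA Y => by rw [hφinv A hA])]
    gcongr K * ?_
    -- This is `(φ - ψ)(ρ(t) - ρ(b)) ≥ 0` written without subtraction. After integration the level
    -- bound on `ψ` cancels the terms in `ρ b`.
    have hpt : ∀ Y, ENNReal.ofReal (ψ Y) * ρ (spikeStat p c Y) + ENNReal.ofReal (φ Y) * ρ b ≤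
        ENNReal.ofReal (φ Y) * ρ (spikeStat p c Y) + ENNReal.ofReal (ψ Y) * ρ b := by
      intro Y
      have hψ1 : ENNReal.ofReal (ψ Y) ≤ 1 := ENNReal.ofReal_le_one.2 (hψ01 Y).2
      by_cases hY : b < spikeStat p c Y
      · have hφY : φ Y = 1 := by simp [hφdef, rejectAbove, hY]
        obtain ⟨d, hd⟩ := exists_add_of_le (hρ hY.le (spikeStat_mem_Icc hc Y).2)
        rw [hφY, ENNReal.ofReal_one, one_mul, one_mul, hd]
        calc ENNReal.ofReal (ψ Y) * (ρ b + d) + ρ b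
            = ENNReal.ofReal (ψ Y) * d + (ENNReal.ofReal (ψ Y) * ρ b + ρ b) := by ring
          _ ≤ 1 * d + (ENNReal.ofReal (ψ Y) * ρ b + ρ b) := by gcongr
          _ = ρ b + d + ENNReal.ofReal (ψ Y) * ρ b := by ring
      · have hφY : φ Y = 0 := by simp [hφdef, rejectAbove, hY]
        rw [hφY, ENNReal.ofReal_zero, zero_mul, zero_mul, add_zero, zero_add]
        gcongr
        exact hρ (not_lt.1 hY) hb
    have hint := lintegral_mono (μ := matrixNormal (0 : Matrix (Fin n) (Fin p) ℝ) 1 1) hpt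
    rw [lintegral_add_left (f := fun Y => ENNReal.ofReal (ψ Y) * ρ (spikeStat p c Y))
      (hψm.ennreal_ofReal.mul hρm),
      lintegral_add_left (f := fun Y => ENNReal.ofReal (φ Y) * ρ (spikeStat p c Y))
      (hφm.ennreal_ofReal.mul hρm), lintegral_mul_const _ hφm.ennreal_ofReal,
      lintegral_mul_const _ hψm.ennreal_ofReal, ← hconv hφm hφ01 _ inferInstance,
      ← hconv hψm hψ01 _ inferInstance, hφ] at hint
    have hfin : ENNReal.ofReal α * ρ b ≠ ∞ :=
      ENNReal.mul_ne_top ENNReal.ofReal_ne_top ENNReal.ofReal_ne_top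
    refine (ENNReal.add_le_add_iff_right hfin).1 (hint.trans ?_)
    gcongr
  exact (ENNReal.ofReal_le_ofReal_iff (integral_nonneg fun Y => (hφ01 Y).1)).1 hφψ

theorem linearGroup_invariant_iff {ψ : Matrix (Fin n) (Fin p) ℝ → ℝ} :
    (∀ g ∈ linearGroup n p, ∀ Y, ψ (g Y) = ψ Y) ↔
      ∀ A : Matrix (Fin p) (Fin p) ℝ, A.det ≠ 0 → ∀ Y, ψ (Y * A) = ψ Y := by
  constructor
  · intro h A hA Y
    refine h (fun Y => Y * A) ⟨Aᵀ, ?_, by rw [Matrix.transpose_transpose]⟩ Y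
    rw [Matrix.det_transpose]
    exact isUnit_iff_ne_zero.2 hA
  · rintro h _ ⟨A, hA, rfl⟩ Y
    exact h Aᵀ (by rw [Matrix.det_transpose]; exact hA.ne_zero) Y

/-- The rejection probability of the spike test. -/
theorem integral_rejectAbove_spikeStat (hp : 0 < p) (hpn : p < n) {c : Fin n → ℝ} (hc : c ⬝ᵥ c = 1)
    {S : Matrix (Fin p) (Fin p) ℝ} (hS : S.PosDef) {ω : ℝ} (hω : 0 ≤ ω) (b : ℝ) :
    ∫ Y, rejectAbove (spikeStat p c) b Y ∂matrixNormal 0 S (spikedCov c ω) =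
      (betaMeasure ((p : ℝ) / 2) (((n : ℝ) - p) / 2)).real {x | (1 + ω) / (1 + x * ω) * x > b} := by
  have hm : Measurable fun x : ℝ => (1 + ω) / (1 + x * ω) * x := by fun_prop
  rw [integral_matrixNormal_of_invariant (measurable_rejectAbove (measurable_spikeStat c) b)
    (rejectAbove_spikeStat_mul c b) hS (posSemidef_spikedCov hω),
    integral_rejectAbove _ (measurable_spikeStat c), map_spikeStat_spikedCov hp hpn hc hω]
  exact map_measureReal_apply hm measurableSet_Ioi

theorem integral_rejectAbove_spikeStat_null (hp : 0 < p) (hpn : p < n) {c : Fin n → ℝ}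
    (hc : c ⬝ᵥ c = 1) {α : ℝ} (hα : 0 < α ∧ α < 1) {S : Matrix (Fin p) (Fin p) ℝ} (hS : S.PosDef) :
    ∫ Y, rejectAbove (spikeStat p c)
      (quantile (betaMeasure ((p : ℝ) / 2) (((n : ℝ) - p) / 2)) (1 - α)) Y ∂matrixNormal 0 S 1 = α := by
  have hpn' : (p : ℝ) < n := by exact_mod_cast hpn
  have h := integral_rejectAbove_spikeStat hp hpn hc hS le_rfl
    (quantile (betaMeasure ((p : ℝ) / 2) (((n : ℝ) - p) / 2)) (1 - α))
  rw [spikedCov_zero] at h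
  rw [h]
  simpa using (betaMeasure_quantile (a := (p : ℝ) / 2) (b := ((n : ℝ) - p) / 2) (by positivity)
    (by linarith) hα).1

theorem isUMPInvariantTest_spikeStat (hp : 0 < p) (hpn : p < n) {c : Fin n → ℝ}
    (hc : c ⬝ᵥ c = 1) {α : ℝ} (hα : 0 < α ∧ α < 1) :
    IsUMPInvariantTest (linearGroup n p) (meanZeroSpiked p c {0}) (meanZeroSpiked p c (Set.Ioi 0)) α
      (rejectAbove (spikeStat p c)
        (quantile (betaMeasure ((p : ℝ) / 2) (((n : ℝ) - p) / 2)) (1 - α))) where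
  measurable := measurable_rejectAbove (measurable_spikeStat c) _
  mem_Icc := rejectAbove_mem_Icc _ _
  invariant := linearGroup_invariant_iff.2 (rejectAbove_spikeStat_mul c _)
  level := by
    rintro μ ⟨S, ω, hS, hω, rfl⟩
    rw [Set.mem_singleton_iff] at hω
    rw [hω, spikedCov_zero, integral_rejectAbove_spikeStat_null hp hpn hc hα hS]
  most_powerful := by
    rintro ψ hψ μ ⟨S, ω, hS, hω, rfl⟩
    have hpn' : (p : ℝ) < n := by exact_mod_cast hpn
    have hinv := linearGroup_invariant_iff.1 hψ.invariant
    have hω0 : (0 : ℝ) < ω := hω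
    rw [integral_matrixNormal_of_invariant hψ.measurable hinv hS (posSemidef_spikedCov hω0.le),
      integral_matrixNormal_of_invariant (measurable_rejectAbove (measurable_spikeStat c) _)
        (rejectAbove_spikeStat_mul c _) hS (posSemidef_spikedCov hω0.le)]
    refine integral_le_of_invariant_level hpn hc hω0
      (betaMeasure_quantile (by positivity) (by linarith) hα).2.2
      (integral_rejectAbove_spikeStat_null hp hpn hc hα Matrix.PosDef.one) hψ.measurable hψ.mem_Icc
      hinv (hψ.level _ ⟨1, 0, Matrix.PosDef.one, rfl, by rw [spikedCov_zero]⟩)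

/-! ### Reduction of the regression model to the mean-zero model -/

theorem det_gram_ne_zero_of_rank {X : Matrix (Fin n) (Fin k) ℝ} (hX : X.rank = k) :
    (Xᵀ * X).det ≠ 0 := by
  rw [det_gram_ne_zero_iff]
  have h := LinearMap.finrank_range_add_finrank_ker X.mulVecLin
  rw [← Matrix.rank, hX, Module.finrank_fin_fun] at h
  have hker : LinearMap.ker X.mulVecLin = ⊥ := Submodule.finrank_eq_zero.1 (by omega)
  exact fun v hv => LinearMap.ker_eq_bot'.1 hker v hv

theorem residProj_eq {X : Matrix (Fin n) (Fin k) ℝ} (hX : X.rank = k) :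
    residProj X = 1 - grass X := by
  rw [residProj, grass_of_det_ne_zero (det_gram_ne_zero_of_rank hX)]

/-- The orthogonal complement of the column space of a matrix of full column rank has an orthonormal
basis. -/
theorem exists_residual_basis {X : Matrix (Fin n) (Fin k) ℝ} (hX : X.rank = k) :
    ∃ Q : Matrix (Fin n) (Fin (n - k)) ℝ, Qᵀ * Q = 1 ∧ residProj X = Q * Qᵀ ∧ Qᵀ * X = 0 := by
  have hP1 : (residProj X)ᵀ = residProj X := by
    rw [residProj_eq hX, Matrix.transpose_sub, grass_transpose, Matrix.transpose_one]
  have hPX : residProj X * X = 0 := by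
    rw [residProj_eq hX, Matrix.sub_mul, grass_mul_self, Matrix.one_mul, sub_self]
  have hP2 : residProj X * residProj X = residProj X := by
    nth_rw 2 [residProj]
    rw [Matrix.mul_sub, Matrix.mul_one, ← Matrix.mul_assoc, ← Matrix.mul_assoc, hPX,
      Matrix.zero_mul, Matrix.zero_mul, sub_zero]
  have hkn : k ≤ n := by
    have := X.rank_le_height
    omega
  obtain ⟨V, s, hV, -, hVP, hs⟩ := exists_orthogonal_diagonalization hP1 hP2
  have hcard : s.card = n - k := by
    have h : (s.card : ℝ) = n - k := by
      rw [hs, residProj_eq hX, Matrix.trace_sub, Matrix.trace_one,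
        trace_grass (det_gram_ne_zero_of_rank hX), Fintype.card_fin]
    rw [← Nat.cast_sub hkn] at h
    exact_mod_cast h
  -- `Q` keeps the eigenvectors of the residual projection with eigenvalue `1`, of which the trace
  -- counts `n - k`.
  let e := s.orderEmbOfFin hcard
  let Q : Matrix (Fin n) (Fin (n - k)) ℝ := V.submatrix id e
  have hQ : Qᵀ * Q = 1 := by
    have h : Qᵀ * Q = (Vᵀ * V).submatrix e e := rfl
    rw [h, hV, Matrix.submatrix_one e e.injective]
  have hQP : residProj X = Q * Qᵀ := by
    ext i j
    rw [hVP, Matrix.mul_apply, Matrix.mul_apply]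
    have h : ∑ l, Q i l * Qᵀ l j = ∑ l ∈ s, V i l * V j l := by
      rw [← Finset.map_orderEmbOfFin_univ s hcard, Finset.sum_map]
      rfl
    rw [h]
    simp [Matrix.mul_diagonal, Finset.sum_ite_mem]
  refine ⟨Q, hQ, hQP, ?_⟩
  calc Qᵀ * X = Qᵀ * (residProj X * X) := by
        rw [hQP, ← Matrix.mul_assoc, ← Matrix.mul_assoc, hQ, Matrix.one_mul]
    _ = 0 := by rw [hPX, Matrix.mul_zero]

/-- The coordinates, in the basis of residuals, of the normalized projection of `c`. -/
def residDirection (Q : Matrix (Fin n) (Fin m) ℝ) (c : Fin n → ℝ) : Fin m → ℝ :=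
  (√(c ⬝ᵥ ((Q * Qᵀ) *ᵥ c)))⁻¹ • (Qᵀ *ᵥ c)

section Reduction

variable {Q : Matrix (Fin n) (Fin m) ℝ} {c : Fin n → ℝ}

theorem dotProduct_transpose_mulVec_self :
    (Qᵀ *ᵥ c) ⬝ᵥ (Qᵀ *ᵥ c) = c ⬝ᵥ ((Q * Qᵀ) *ᵥ c) := by
  have h := dotProduct_mulVec_conj Qᵀ 1 c
  rwa [Matrix.one_mulVec, Matrix.transpose_transpose, Matrix.mul_one] at h

theorem dotProduct_projection_pos (hQ : Qᵀ * Q = 1) (hc : (Q * Qᵀ) *ᵥ c ≠ 0) :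
    0 < c ⬝ᵥ ((Q * Qᵀ) *ᵥ c) := by
  have h2 : Q * Qᵀ * (Q * Qᵀ) = Q * Qᵀ := by
    rw [Matrix.mul_assoc, ← Matrix.mul_assoc Qᵀ, hQ, Matrix.one_mul]
  rw [← dotProduct_mulVec_self_of_idempotent (by simp [Matrix.transpose_mul]) h2]
  refine lt_of_le_of_ne (Finset.sum_nonneg fun i _ => mul_self_nonneg _) fun h => hc ?_
  exact dotProduct_self_eq_zero.1 h.symm

theorem residDirection_dotProduct_self (hd : 0 < c ⬝ᵥ ((Q * Qᵀ) *ᵥ c)) :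
    residDirection Q c ⬝ᵥ residDirection Q c = 1 := by
  rw [residDirection, smul_dotProduct, dotProduct_smul, dotProduct_transpose_mulVec_self, smul_eq_mul,
    smul_eq_mul, ← mul_assoc, ← mul_inv, Real.mul_self_sqrt hd.le, inv_mul_cancel₀ hd.ne']

/-- Since `PY = Q(QᵀY)`, the projection `G(PY)` is `Q G(QᵀY) Qᵀ`; dividing by `cᵀPc` normalizes
`Qᵀc` to a unit vector. -/
theorem residSpikeStat_eq {X : Matrix (Fin n) (Fin k) ℝ} (hQ : Qᵀ * Q = 1)
    (hX : residProj X = Q * Qᵀ) (hd : 0 < c ⬝ᵥ ((Q * Qᵀ) *ᵥ c)) (Y : Matrix (Fin n) (Fin p) ℝ) :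
    residSpikeStat p X c Y = spikeStat p (residDirection Q c) (Qᵀ * Y) := by
  have h := dotProduct_mulVec_conj Qᵀ (grass (Qᵀ * Y)) c
  rw [Matrix.transpose_transpose] at h
  rw [residSpikeStat, hX, Matrix.mul_assoc Q, grass_orthogonal_mul hQ, ← h, spikeStat_eq,
    residDirection, Matrix.mulVec_smul, smul_dotProduct, dotProduct_smul, smul_eq_mul, smul_eq_mul,
    ← mul_assoc, ← mul_inv, Real.mul_self_sqrt hd.le, div_eq_inv_mul]

/-- `Qᵀc` has squared length `cᵀPc`, and normalizing it moves that factor into the spike: the source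
of `ω̃`. -/
theorem conj_spikedCov (hQ : Qᵀ * Q = 1) (hd : 0 < c ⬝ᵥ ((Q * Qᵀ) *ᵥ c)) (ω : ℝ) :
    Qᵀ * spikedCov c ω * Q = spikedCov (residDirection Q c) (ω * (c ⬝ᵥ ((Q * Qᵀ) *ᵥ c))) := by
  rw [spikedCov, spikedCov, Matrix.mul_add, Matrix.add_mul, Matrix.mul_one, hQ, Matrix.mul_smul,
    Matrix.smul_mul, Matrix.mul_vecMulVec, Matrix.vecMulVec_mul, residDirection,
    Matrix.smul_vecMulVec, Matrix.vecMulVec_smul, smul_smul, smul_smul, ← Matrix.mulVec_transpose]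
  congr 2
  have h := Real.mul_self_sqrt hd.le
  have h0 := (Real.sqrt_pos.2 hd).ne'
  nth_rw 1 [← h]
  field_simp

theorem map_transpose_mul_matrixNormal {X : Matrix (Fin n) (Fin k) ℝ} (hQ : Qᵀ * Q = 1)
    (hQX : Qᵀ * X = 0) (hd : 0 < c ⬝ᵥ ((Q * Qᵀ) *ᵥ c)) (B : Matrix (Fin p) (Fin k) ℝ)
    {S : Matrix (Fin p) (Fin p) ℝ} (hS : S.PosDef) {ω : ℝ} (hω : 0 ≤ ω) :
    (matrixNormal (X * Bᵀ) S (spikedCov c ω)).map (fun Y => Qᵀ * Y) =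
      matrixNormal 0 S (spikedCov (residDirection Q c) (ω * (c ⬝ᵥ ((Q * Qᵀ) *ᵥ c)))) := by
  have h := matrixNormal_map_affine (X * Bᵀ) hS.posSemidef (posSemidef_spikedCov (c := c) hω) 0 Qᵀ
    (1 : Matrix (Fin p) (Fin p) ℝ)
  simpa only [Matrix.transpose_one, Matrix.mul_one, Matrix.one_mul, zero_add,
    Matrix.transpose_transpose, ← Matrix.mul_assoc, hQX, Matrix.zero_mul,
    conj_spikedCov hQ hd] using h

/-- Subtracting the least-squares fit is, for each given `Y`, the action of a group element with `A
= 1`, so an invariant function depends on the residuals alone. -/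
theorem regressionGroup_invariant {X : Matrix (Fin n) (Fin k) ℝ} (hX : residProj X = Q * Qᵀ)
    {ψ : Matrix (Fin n) (Fin p) ℝ → ℝ} (hψ : ∀ g ∈ regressionGroup p X, ∀ Y, ψ (g Y) = ψ Y)
    (Y : Matrix (Fin n) (Fin p) ℝ) : ψ (Q * (Qᵀ * Y)) = ψ Y := by
  have h := hψ _ ⟨-((Xᵀ * X)⁻¹ * Xᵀ * Y)ᵀ, 1, by rw [Matrix.det_one]; exact isUnit_one, rfl⟩ Y
  rw [← h, ← Matrix.mul_assoc, ← hX, residProj, Matrix.transpose_neg, Matrix.transpose_transpose,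
    Matrix.transpose_one, Matrix.mul_one, Matrix.sub_mul, Matrix.one_mul, Matrix.mul_neg,
    sub_eq_neg_add]
  simp only [Matrix.mul_assoc]

end Reduction

section Regression

variable {X : Matrix (Fin n) (Fin k) ℝ} {c : Fin n → ℝ}

/-- The regression model reduces to the mean-zero model of the coordinates of the residuals. -/
theorem exists_regression_reduction (hX : X.rank = k) (hc : residProj X *ᵥ c ≠ 0) :
    ∃ (Q : Matrix (Fin n) (Fin (n - k)) ℝ) (d : Fin (n - k) → ℝ), Qᵀ * Q = 1 ∧ Qᵀ * X = 0 ∧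
      d ⬝ᵥ d = 1 ∧ 0 < c ⬝ᵥ (residProj X *ᵥ c) ∧
      (∀ Y : Matrix (Fin n) (Fin p) ℝ, residSpikeStat p X c Y = spikeStat p d (Qᵀ * Y)) ∧
      (∀ (B : Matrix (Fin p) (Fin k) ℝ) (S : Matrix (Fin p) (Fin p) ℝ) (ω : ℝ), S.PosDef → 0 ≤ ω →
        (matrixNormal (X * Bᵀ) S (spikedCov c ω)).map (fun Y => Qᵀ * Y) =
          matrixNormal 0 S (spikedCov d (ω * (c ⬝ᵥ (residProj X *ᵥ c))))) ∧
      ∀ ψ : Matrix (Fin n) (Fin p) ℝ → ℝ, (∀ g ∈ regressionGroup p X, ∀ Y, ψ (g Y) = ψ Y) →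
        ∀ Y, ψ (Q * (Qᵀ * Y)) = ψ Y := by
  obtain ⟨Q, hQ, hQP, hQX⟩ := exists_residual_basis hX
  have hd := dotProduct_projection_pos hQ (hQP ▸ hc)
  refine ⟨Q, residDirection Q c, hQ, hQX, residDirection_dotProduct_self hd, hQP ▸ hd,
    residSpikeStat_eq hQ hQP hd, fun B S ω hS hω => ?_, fun ψ => regressionGroup_invariant hQP⟩
  rw [hQP]
  exact map_transpose_mul_matrixNormal hQ hQX hd B hS hω

theorem map_residSpikeStat (hp : 0 < p) (hpn : p + k < n) (hX : X.rank = k)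
    (hc : residProj X *ᵥ c ≠ 0) (B : Matrix (Fin p) (Fin k) ℝ) {S : Matrix (Fin p) (Fin p) ℝ}
    (hS : S.PosDef) :
    (matrixNormal (X * Bᵀ) S (spikedCov c 0)).map (residSpikeStat p X c) =
      betaMeasure ((p : ℝ) / 2) (((n : ℝ) - k - p) / 2) := by
  obtain ⟨Q, d, -, -, hd, -, hstat, hmap, -⟩ := exists_regression_reduction (p := p) hX hc
  have hcast : ((n - k : ℕ) : ℝ) = (n : ℝ) - k := Nat.cast_sub (by omega)
  rw [funext hstat]
  have h : (fun Y : Matrix (Fin n) (Fin p) ℝ => spikeStat p d (Qᵀ * Y)) =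
      spikeStat p d ∘ fun Y => Qᵀ * Y := rfl
  rw [h, ← Measure.map_map (measurable_spikeStat d) (measurable_mul_left _), hmap B S 0 hS le_rfl,
    zero_mul, spikedCov_zero, ← hcast, ← map_spikeStat hp (by omega) hd]
  refine Measure.ext fun s hs => ?_
  -- The laws under `S` and under the identity are compared set by set, as integrals of invariant
  -- indicators.
  have hprob : ∀ S : Matrix (Fin p) (Fin p) ℝ, IsProbabilityMeasure
      ((matrixNormal (0 : Matrix (Fin (n - k)) (Fin p) ℝ) S 1).map (spikeStat p d)) := fun S =>
    Measure.isProbabilityMeasure_map (measurable_spikeStat d).aemeasurable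
  have hprob1 := hprob 1
  have hprobS := hprob S
  rw [← measureReal_eq_measureReal_iff, ← integral_indicator_one hs, ← integral_indicator_one hs,
    integral_map (measurable_spikeStat d).aemeasurable
      (measurable_one.indicator hs).aestronglyMeasurable,
    integral_map (measurable_spikeStat d).aemeasurable
      (measurable_one.indicator hs).aestronglyMeasurable]
  refine integral_matrixNormal_of_invariant
    ((measurable_one.indicator hs).comp (measurable_spikeStat d)) (fun A hA Y => ?_) hS
    Matrix.PosSemidef.one
  have h : spikeStat p d (Y * A) = spikeStat p d Y := by
    rw [spikeStat_eq, spikeStat_eq, grass_mul_right Y (isUnit_iff_ne_zero.2 hA)]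
  exact congrArg (s.indicator 1) h

theorem integral_rejectAbove_residSpikeStat (hp : 0 < p) (hpn : p + k < n) (hX : X.rank = k)
    (hc : residProj X *ᵥ c ≠ 0) (B : Matrix (Fin p) (Fin k) ℝ) {S : Matrix (Fin p) (Fin p) ℝ}
    (hS : S.PosDef) {ω : ℝ} (hω : 0 ≤ ω) {b : ℝ} (hb : b ≤ 1) :
    ∫ Y, rejectAbove (residSpikeStat p X c) b Y ∂matrixNormal (X * Bᵀ) S (spikedCov c ω) =
      (betaMeasure ((p : ℝ) / 2) (((n : ℝ) - k - p) / 2)).real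
        {x | x > b / (1 + ω * (c ⬝ᵥ (residProj X *ᵥ c)) * (1 - b))} := by
  obtain ⟨Q, d, -, -, hd, hpos, hstat, hmap, -⟩ := exists_regression_reduction (p := p) hX hc
  have hcast : ((n - k : ℕ) : ℝ) = (n : ℝ) - k := Nat.cast_sub (by omega)
  have hω' : 0 ≤ ω * (c ⬝ᵥ (residProj X *ᵥ c)) := by positivity
  rw [funext hstat, ← hcast, ← betaMeasure_spiked_tail hω' hb,
    ← integral_rejectAbove_spikeStat hp (by omega) hd hS hω' b, ← hmap B S ω hS hω,
    integral_map (measurable_mul_left _).aemeasurable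
      (measurable_rejectAbove (measurable_spikeStat d) b).aestronglyMeasurable]
  rfl

/-- A competitor `ψ` becomes the competitor `W ↦ ψ(QW)` in the mean-zero model. As `ψ(QQᵀY) = ψ(Y)`,
level and power are unchanged, and optimality there transfers back. -/
theorem isUMPInvariantTest_residSpikeStat (hp : 0 < p) (hpn : p + k < n) (hX : X.rank = k)
    (hc : residProj X *ᵥ c ≠ 0) {α : ℝ} (hα : 0 < α ∧ α < 1) :
    IsUMPInvariantTest (regressionGroup p X) (regressionSpiked p X c {0})
      (regressionSpiked p X c (Set.Ioi 0)) α
      (rejectAbove (residSpikeStat p X c)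
        (quantile (betaMeasure ((p : ℝ) / 2) (((n : ℝ) - k - p) / 2)) (1 - α))) := by
  obtain ⟨Q, d, hQ, hQX, hd, hpos, hstat, hmap, hinv⟩ := exists_regression_reduction (p := p) hX hc
  have hcast : ((n - k : ℕ) : ℝ) = (n : ℝ) - k := Nat.cast_sub (by omega)
  have hump := isUMPInvariantTest_spikeStat (n := n - k) hp (by omega) hd hα
  rw [hcast] at hump
  set b := quantile (betaMeasure ((p : ℝ) / 2) (((n : ℝ) - k - p) / 2)) (1 - α)
  have hstat' : ∀ Y, rejectAbove (residSpikeStat p X c) b Y =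
      rejectAbove (spikeStat p d) b (Qᵀ * Y) := fun Y => by rw [funext hstat]; rfl
  have hQm : Measurable fun Y : Matrix (Fin n) (Fin p) ℝ => Qᵀ * Y := measurable_mul_left _
  -- Both `{0}` and the positive half-line are stable under multiplication by `cᵀPc > 0`, so null
  -- laws map to null laws and alternatives to alternatives.
  have hmem : ∀ {W : Set ℝ}, (∀ ω ∈ W, 0 ≤ ω) →
      (∀ ω ∈ W, ω * (c ⬝ᵥ (residProj X *ᵥ c)) ∈ W) → ∀ μ ∈ regressionSpiked p X c W,
      μ.map (fun Y => Qᵀ * Y) ∈ meanZeroSpiked p d W := by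
    rintro W hW0 hW μ ⟨B, S, ω, hS, hω, rfl⟩
    exact ⟨S, _, hS, hW ω hω, hmap B S ω hS (hW0 ω hω)⟩
  have hH := hmem (W := {0}) (by simp) (by simp)
  have hK := hmem (W := Set.Ioi 0) (fun ω hω => le_of_lt hω) (fun ω hω => mul_pos hω hpos)
  have hint : ∀ μ : Measure (Matrix (Fin n) (Fin p) ℝ),
      ∫ Y, rejectAbove (residSpikeStat p X c) b Y ∂μ =
        ∫ W, rejectAbove (spikeStat p d) b W ∂μ.map (fun Y => Qᵀ * Y) := fun μ => by
    rw [integral_map hQm.aemeasurable hump.measurable.aestronglyMeasurable]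
    simp only [hstat']
  refine ⟨⟨?_, rejectAbove_mem_Icc _ _, ?_, fun μ hμ => ?_⟩, fun ψ hψ μ hμ => ?_⟩
  · rw [funext hstat']
    exact hump.measurable.comp hQm
  · rintro _ ⟨C, A, hA, rfl⟩ Y
    rw [hstat', hstat', Matrix.mul_add, ← Matrix.mul_assoc, hQX, Matrix.zero_mul, zero_add,
      ← Matrix.mul_assoc]
    exact hump.invariant _ ⟨A, hA, rfl⟩ _
  · rw [hint]
    exact hump.level _ (hH μ hμ)
  · have hQm' : Measurable fun W : Matrix (Fin (n - k)) (Fin p) ℝ => Q * W := measurable_mul_left _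
    have hψQm : Measurable fun W : Matrix (Fin (n - k)) (Fin p) ℝ => ψ (Q * W) :=
      hψ.measurable.comp hQm'
    have hψint : ∀ μ : Measure (Matrix (Fin n) (Fin p) ℝ),
        ∫ Y, ψ Y ∂μ = ∫ W, ψ (Q * W) ∂μ.map (fun Y => Qᵀ * Y) := fun μ => by
      rw [integral_map hQm.aemeasurable hψQm.aestronglyMeasurable]
      simp only [hinv ψ hψ.invariant]
    rw [hint, hψint]
    refine hump.most_powerful (fun W => ψ (Q * W)) ⟨hψQm, fun W => hψ.mem_Icc _, ?_, ?_⟩ _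
      (hK μ hμ)
    · rintro _ ⟨A, hA, rfl⟩ W
      have h := hψ.invariant _ ⟨0, A, hA, rfl⟩ (Q * W)
      rwa [Matrix.transpose_zero, Matrix.mul_zero, zero_add, Matrix.mul_assoc] at h
    · rintro μ ⟨S, ω, hS, hω, rfl⟩
      rw [Set.mem_singleton_iff] at hω
      -- Every null law of the reduced model is the image of a regression null law, namely the one
      -- with `B = 0`; hence `ψ(Q·)` inherits the level of `ψ`.
      have h := hmap 0 S 0 hS le_rfl
      rw [zero_mul] at h
      rw [hω, ← h, ← hψint]
      exact hψ.level _ ⟨0, S, 0, hS, rfl, rfl⟩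

end Regression

end RowCov

end

theorem mainTheorem5 (α : ℝ) (hα : 0 < α ∧ α < 1) :
    -- the mean-zero rank-1 spiked model
    (∀ (n p : ℕ) (c : Fin n → ℝ), 0 < p → p < n → c ⬝ᵥ c = 1 →
      ∀ (β : Measure ℝ) (b₀ : ℝ), β = betaMeasure ((p : ℝ) / 2) (((n : ℝ) - p) / 2) →
        b₀ = RowCov.quantile β (1 - α) →
      RowCov.IsUMPInvariantTest (RowCov.linearGroup n p)
          (RowCov.meanZeroSpiked p c {0}) (RowCov.meanZeroSpiked p c (Set.Ioi 0)) α
          (RowCov.rejectAbove (RowCov.spikeStat p c) b₀) ∧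
        (∀ μ ∈ RowCov.meanZeroSpiked p c {0},
          ∫ Y, RowCov.rejectAbove (RowCov.spikeStat p c) b₀ Y ∂μ = α) ∧
        ∀ (S : Matrix (Fin p) (Fin p) ℝ) (ω : ℝ), S.PosDef → 0 ≤ ω →
          ∫ Y, RowCov.rejectAbove (RowCov.spikeStat p c) b₀ Y
              ∂(RowCov.matrixNormal 0 S (RowCov.spikedCov c ω)) =
            β.real {b | (1 + ω) / (1 + b * ω) * b > b₀} ∧
          β.real {b | (1 + ω) / (1 + b * ω) * b > b₀} =
            β.real {b | b > b₀ / (1 + ω * (1 - b₀))}) ∧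
    -- the regression model
    (∀ (n p q : ℕ) (X : Matrix (Fin n) (Fin q) ℝ) (c : Fin n → ℝ), 0 < p → p + q < n →
        X.rank = q → c ⬝ᵥ c = 1 → RowCov.residProj X *ᵥ c ≠ 0 →
      ∀ (β : Measure ℝ) (b₀ : ℝ), β = betaMeasure ((p : ℝ) / 2) (((n : ℝ) - q - p) / 2) →
        b₀ = RowCov.quantile β (1 - α) →
      RowCov.IsUMPInvariantTest (RowCov.regressionGroup p X)
          (RowCov.regressionSpiked p X c {0}) (RowCov.regressionSpiked p X c (Set.Ioi 0)) α
          (RowCov.rejectAbove (RowCov.residSpikeStat p X c) b₀) ∧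
        (∀ μ ∈ RowCov.regressionSpiked p X c {0},
          μ.map (RowCov.residSpikeStat p X c) = β) ∧
        ∀ (B : Matrix (Fin p) (Fin q) ℝ) (S : Matrix (Fin p) (Fin p) ℝ) (ω ω' : ℝ), S.PosDef →
          0 ≤ ω → ω' = ω * (c ⬝ᵥ (RowCov.residProj X *ᵥ c)) →
          ∫ Y, RowCov.rejectAbove (RowCov.residSpikeStat p X c) b₀ Y
              ∂(RowCov.matrixNormal (X * Bᵀ) S (RowCov.spikedCov c ω)) =
            β.real {b | b > b₀ / (1 + ω' * (1 - b₀))}) := by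
  refine ⟨fun n p c hp hpn hc β b₀ hβ hb₀ => ?_, fun n p q X c hp hpn hX hc hPc β b₀ hβ hb₀ => ?_⟩
  · subst hβ hb₀
    have hpn' : (p : ℝ) < n := by exact_mod_cast hpn
    refine ⟨RowCov.isUMPInvariantTest_spikeStat hp hpn hc hα, ?_, fun S ω hS hω =>
      ⟨RowCov.integral_rejectAbove_spikeStat hp hpn hc hS hω _, RowCov.betaMeasure_spiked_tail hω
        (RowCov.betaMeasure_quantile (by positivity) (by linarith) hα).2.2⟩⟩
    rintro μ ⟨S, ω, hS, hω, rfl⟩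
    rw [Set.mem_singleton_iff] at hω
    rw [hω, RowCov.spikedCov_zero, RowCov.integral_rejectAbove_spikeStat_null hp hpn hc hα hS]
  · subst hβ hb₀
    have hpn' : (p : ℝ) + q < n := by exact_mod_cast hpn
    refine ⟨RowCov.isUMPInvariantTest_residSpikeStat hp hpn hX hPc hα, ?_, ?_⟩
    · rintro μ ⟨B, S, ω, hS, hω, rfl⟩
      rw [Set.mem_singleton_iff] at hω
      rw [hω, RowCov.map_residSpikeStat hp hpn hX hPc B hS]
    · rintro B S ω ω' hS hω rfl
      exact RowCov.integral_rejectAbove_residSpikeStat hp hpn hX hPc B hS hω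
        (RowCov.betaMeasure_quantile (by positivity) (by linarith) hα).2.2
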